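/- For a function \(f:\mathbb{R}\to\mathbb{R}\) let \(Mf(x)=\sup_{a<x<b}\frac1{b-a}\int_a^b f(t)\,dt\) be its uncentered Hardy--Littlewood maximal function (without absolute values). For \(g\in L^1_{\mathrm{loc}}(\mathbb{R})\) let \(\operatorname{var}(g)=\sup\{-\int_{\mathbb{R}} g\varphi' : \varphi\in C^1_c(\mathbb{R}),\ |\varphi|\le 1\}\in[0,\infty]\). Let \(\operatorname{var}(f')\) denote the variation of the weak derivative of \(f\), with \(\operatorname{var}(f')=\infty\) if \(f\) is not locally integrable with a locally integrable weak derivative. **Theorem.** For every \(c>0\) there exists a \(C>0\) such that the following holds. Let \(f:\mathbb{R}\to\mathbb{R}\) be nondecreasing on \((-\infty,0)\) and nonincreasing on \((0,\infty)\), and suppose that \[ Mf(x)=\sup_{y\ge -cx,\ y\ne x}\frac1{x-y}\int_y^x f(t)\,dt\quad\text{for every }x>0, \] \[ Mf(x)=\sup_{y\le -cx,\ y\ne x}\frac1{x-y}\int_y^x f(t)\,dt\quad\text{for every }x<0. \] Then \(\operatorname{var}((Mf)')\le C\operatorname{var}(f')\). In particular, if \(f\) is weakly differentiable and \(\operatorname{var}(f')<\infty\),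 then \(Mf\) is weakly differentiable and \((Mf)'\) has finite variation. -/

import Mathlib

open MeasureTheory Set
open scoped ENNReal

noncomputable section

namespace SecondDerivMaximal

/-- The average `(b - a)⁻¹ ∫_a^b f`. It is symmetric in `a` and `b`, and it is only used
for `a ≠ b`. -/
def average (f : ℝ → ℝ) (a b : ℝ) : ℝ :=
  (b - a)⁻¹ * ∫ t in a..b, f t

/-- The uncentered Hardy-Littlewood maximal function (without absolute values),
`M f x = sup_{a < x < b} (b - a)⁻¹ ∫_a^b f`. The supremum is finite for every `f` which is
bounded above, in particular for every weakly differentiable `f` that is nondecreasing on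
`(-∞, 0)` and nonincreasing on `(0, ∞)`. -/
def maximal (f : ℝ → ℝ) (x : ℝ) : ℝ :=
  sSup {m : ℝ | ∃ a b : ℝ, a < x ∧ x < b ∧ m = average f a b}

/-- `g` is a weak derivative of `f` on `ℝ`. -/
structure HasWeakDeriv (f g : ℝ → ℝ) : Prop where
  locallyIntegrable : LocallyIntegrable f
  locallyIntegrable_deriv : LocallyIntegrable g
  integral_eq : ∀ φ : ℝ → ℝ, ContDiff ℝ 1 φ → HasCompactSupport φ →
    ∫ x, g x * φ x = -∫ x, f x * deriv φ x

/-- The variation of a locally integrable function `g` on `ℝ`: the supremum of `-∫ g φ'`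
over all `φ` in `C¹_c(ℝ)` with `|φ| ≤ 1`. (The supremum is nonnegative, as `φ = 0` is
admissible.) -/
def variation (g : ℝ → ℝ) : ℝ≥0∞ :=
  ⨆ (φ : ℝ → ℝ) (_ : ContDiff ℝ 1 φ) (_ : HasCompactSupport φ) (_ : ∀ x, |φ x| ≤ 1),
    ENNReal.ofReal (-∫ x, g x * deriv φ x)

/-- `var(f')`, the variation of the weak derivative of `f`. Weak derivatives are unique up to
null sets and `variation` does not see null sets, so the infimum is over a single value; it
is `∞` if `f` has no weak derivative. -/
def variationDeriv (f : ℝ → ℝ) : ℝ≥0∞ :=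
  ⨅ (g : ℝ → ℝ) (_ : HasWeakDeriv f g), variation g

end SecondDerivMaximal

end

open Filter Topology

/-! Finite variation is handled through domination: if every increment of `h` is at most that of a
monotone `T`, then `variation h` is at most the oscillation of `T`. Conversely, a function of
variation `V` has a representative dominated by a monotone function with values in `[0, V]`. So it
suffices to find the derivative of the maximal function off a countable set and to dominate it.

Replace `f` by its continuous representative `F` and reflect, so that only `x > 0` matters. Put `P x
= F 0 - F x`, `Q s = F 0 - F (-s)` and `M = F 0 - maximal F`; `P` and `Q` are nonnegative and
nondecreasing on the half-line. `M x` is the least average of the deficit over `[-s, x]`, attained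
at some `s ≤ c * x`. Stationarity gives `Q s = M x`, the least minimizer `s x` is monotone in `x`,
and an envelope argument gives `M' = (P - M) / (x + s)`.

In the scale-invariant quantities `α = P / x`, `β = (∫ P) / x²`, `γ = Q s / s`, `η = (∫ Q) / s²` and
`r = s / x ≤ c`, this reads `M' = (α - r γ) / (1 + r)` with `γ r + (γ - η) r² = β`. The functions
`α, β, γ, η` are averages of `F'`, so they are dominated (those evaluated at `s` because `s` is
monotone). What remains is to control `(α + γ) |dr|`. The quadratic relation controls `γ |dr|`. For
`α |dr|`, the upward movement of `r` is paid for by the bounded quantity `α r`. The downward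
movement is slow, since `s = x r` is nondecreasing, and is absorbed by the growth of `∫ P`
(`abs_slope_sub_le`). -/

namespace SecondDerivMaximal

/-! ### Domination by monotone functions and the variation -/

/-- The increments of `h` on `s` are bounded by those of `T`. -/
def DominatedOn (h T : ℝ → ℝ) (s : Set ℝ) : Prop :=
  ∀ x ∈ s, ∀ y ∈ s, x ≤ y → |h y - h x| ≤ T y - T x

theorem DominatedOn.monotoneOn {h T : ℝ → ℝ} {s : Set ℝ} (H : DominatedOn h T s) :
    MonotoneOn T s := fun x hx y hy hxy => by
  linarith [H x hx y hy hxy, abs_nonneg (h y - h x)]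

theorem DominatedOn.monotoneOn_sub {h T : ℝ → ℝ} {s : Set ℝ} (H : DominatedOn h T s) :
    MonotoneOn (fun x => T x - h x) s := fun x hx y hy hxy => by
  have := (abs_le.1 (H x hx y hy hxy)).2
  simp only; linarith

theorem DominatedOn.locallyIntegrable {h T : ℝ → ℝ} (H : DominatedOn h T univ) :
    LocallyIntegrable h := by
  have h1 : Monotone T := monotoneOn_univ.1 H.monotoneOn
  have h2 : Monotone (fun x => T x - h x) := monotoneOn_univ.1 H.monotoneOn_sub
  have := (h1.locallyIntegrable (μ := volume)).sub (h2.locallyIntegrable (μ := volume))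
  have e : h = T - (fun x => T x - h x) := by ext x; simp
  rw [e]; exact this

theorem DominatedOn.continuousAt {h T : ℝ → ℝ} (H : DominatedOn h T univ) {x : ℝ}
    (hx : ContinuousAt T x) : ContinuousAt h x := by
  have h0 : Tendsto (fun y => |T y - T x|) (𝓝 x) (𝓝 0) := by
    have : Tendsto (fun y => |T y - T x|) (𝓝 x) (𝓝 |T x - T x|) :=
      (hx.tendsto.sub_const _).abs
    simpa using this
  refine tendsto_iff_norm_sub_tendsto_zero.2 (squeeze_zero (fun y => norm_nonneg _) (fun y => ?_) h0)
  rw [Real.norm_eq_abs]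
  rcases le_total x y with hxy | hxy
  · exact (H x trivial y trivial hxy).trans (le_abs_self _)
  · rw [abs_sub_comm, abs_sub_comm (T y)]
    exact (H y trivial x trivial hxy).trans (le_abs_self _)

/-- Integration by parts on an interval around the support of `φ`. The fundamental theorem of
calculus tolerates a countable exceptional set; in the applications this comes from discontinuities
of monotone functions. -/
theorem integral_mul_eq_neg_integral_mul_deriv {G h φ : ℝ → ℝ} {D : Set ℝ} (hD : D.Countable)
    (hG : Continuous G) (hd : ∀ x ∉ D, HasDerivAt G (h x) x) (hh : LocallyIntegrable h)
    (hφ : ContDiff ℝ 1 φ) (hs : HasCompactSupport φ) :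
    ∫ x, h x * φ x = -∫ x, G x * deriv φ x := by
  have hφ' : Continuous (deriv φ) := hφ.continuous_deriv le_rfl
  have i1 : Integrable (fun x => h x * φ x) := by
    simpa using hh.integrable_smul_right_of_hasCompactSupport hφ.continuous hs
  have i2 : Integrable (fun x => G x * deriv φ x) :=
    (hG.mul hφ').integrable_of_hasCompactSupport hs.deriv.mul_left
  obtain ⟨R, hR⟩ := hs.isCompact.isBounded.subset_closedBall 0
  have hz : ∀ x, x ∉ Icc (-R) R → φ x = 0 := fun x hx => by
    by_contra hne
    have := hR (subset_tsupport _ hne)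
    rw [Real.closedBall_eq_Icc] at this
    exact hx (by simpa using this)
  set a := -|R| - 1
  set b := |R| + 1
  have hab : a ≤ b := by simp only [a, b]; linarith [abs_nonneg R]
  have key : ∫ x in a..b, (h x * φ x + G x * deriv φ x) = G b * φ b - G a * φ a := by
    refine integral_eq_of_hasDerivAt_off_countable (fun x => G x * φ x) _ hD
      (hG.mul hφ.continuous).continuousOn (fun x hx => ?_) (i1.add i2).intervalIntegrable
    exact (hd x hx.2).mul ((hφ.differentiable one_ne_zero) x).hasDerivAt
  have hout : ∀ x, x ∉ Ioc a b → x ∉ Icc (-R) R := by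
    intro x hx hx'
    refine hx ⟨?_, ?_⟩
    · simp only [a]; linarith [le_abs_self R, hx'.1]
    · simp only [b]; linarith [le_abs_self R, hx'.2]
  have za : φ a = 0 := hz _ (hout _ (by simp))
  have zb : φ b = 0 := hz _ (fun hx' => by
    have := hx'.2; simp only [b] at this; linarith [le_abs_self R])
  have hsub : tsupport φ ⊆ Ioc a b := by
    intro x hx
    by_contra hx'
    have := hR hx
    rw [Real.closedBall_eq_Icc] at this
    exact hout x hx' (by simpa using this)
  rw [za, zb, intervalIntegral.integral_of_le hab,
    setIntegral_eq_integral_of_forall_compl_eq_zero, integral_add i1 i2] at key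
  · linarith
  · intro x hx
    have h1 : φ x = 0 := hz _ (hout _ hx)
    have h2 : deriv φ x = 0 := by
      by_contra hne
      exact hx (hsub (support_deriv_subset hne))
    simp [h1, h2]

/-- Replace `deriv φ` by a difference quotient and move the shift onto `h`. The increments of `h`
are then replaced by those of `T`, whose integral telescopes to two boundary layers of width `e n`,
where only the bounds on `T` matter. -/
theorem variation_le_of_dominatedOn {h T : ℝ → ℝ} (H : DominatedOn h T univ) {a V : ℝ}
    (ha : ∀ x, a ≤ T x) (hb : ∀ x, T x ≤ a + V) : variation h ≤ ENNReal.ofReal V := by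
  have hT : Monotone T := monotoneOn_univ.1 H.monotoneOn
  have hh := H.locallyIntegrable
  refine iSup_le fun φ => iSup_le fun hφ => iSup_le fun hs => iSup_le fun h1 => ?_
  refine ENNReal.ofReal_le_ofReal ?_
  have hφd : Differentiable ℝ φ := hφ.differentiable one_ne_zero
  have hφ' : Continuous (deriv φ) := hφ.continuous_deriv le_rfl
  obtain ⟨L, hL⟩ := hφ'.bounded_above_of_compact_support hs.deriv
  obtain ⟨R, hR⟩ := hs.isCompact.isBounded.subset_closedBall 0
  have hz : ∀ x, x ∉ Icc (-R) R → φ x = 0 := fun x hx => by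
    by_contra hne
    have := hR (subset_tsupport _ hne)
    rw [Real.closedBall_eq_Icc] at this
    exact hx (by simpa using this)
  have lip : ∀ x y, |φ y - φ x| ≤ L * |y - x| := fun x y => by
    simpa using Convex.norm_image_sub_le_of_norm_deriv_le (f := φ) (s := univ)
      (fun z _ => hφd z) (fun z _ => hL z) convex_univ (mem_univ x) (mem_univ y)
  set e : ℕ → ℝ := fun n => 1 / ((n : ℝ) + 1)
  have e0 : ∀ n, 0 < e n := fun n => Nat.one_div_pos_of_nat
  have e1 : ∀ n, e n ≤ 1 := fun n => by
    simp only [e]; rw [div_le_one (by positivity)]; linarith [Nat.cast_nonneg (α := ℝ) n]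
  have etend : Tendsto e atTop (𝓝 0) := tendsto_one_div_add_atTop_nhds_zero_nat
  -- The margin exceeds the shift `e n ≤ 1`, so that `φ` and its translates vanish outside `[-B,
  -- B]`.
  set B := |R| + 2
  have hlim : Tendsto (fun n => ∫ x, h x * ((e n)⁻¹ * (φ (x + e n) - φ x))) atTop
      (𝓝 (∫ x, h x * deriv φ x)) := by
    refine tendsto_integral_of_dominated_convergence
      (fun x => (Icc (-B) B).indicator (fun x => ‖h x‖ * L) x) (fun n => ?_) ?_ (fun n => ?_) ?_
    · exact hh.aestronglyMeasurable.mul (by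
        have := hφ.continuous
        exact (by fun_prop : Continuous fun x => (e n)⁻¹ * (φ (x + e n) - φ x)).aestronglyMeasurable)
    · rw [integrable_indicator_iff measurableSet_Icc]
      exact (hh.integrableOn_isCompact isCompact_Icc).norm.mul_const L
    · refine ae_of_all _ fun x => ?_
      by_cases hx : x ∈ Icc (-B) B
      · rw [indicator_of_mem hx, norm_mul]
        gcongr
        rw [Real.norm_eq_abs, abs_mul, abs_of_pos (inv_pos.2 (e0 n)), inv_mul_le_iff₀ (e0 n)]
        have := lip x (x + e n)
        rwa [add_sub_cancel_left, abs_of_pos (e0 n), mul_comm] at this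
      · rw [indicator_of_notMem hx]
        have z1 : φ x = 0 := hz x fun h' => hx ⟨by
          simp only [B]; linarith [h'.1, le_abs_self R], by
          simp only [B]; linarith [h'.2, le_abs_self R]⟩
        have z2 : φ (x + e n) = 0 := hz _ fun h' => hx ⟨by
          simp only [B]; linarith [h'.1, le_abs_self R, e1 n], by
          simp only [B]; linarith [h'.2, le_abs_self R, e0 n]⟩
        simp [z1, z2]
    · refine ae_of_all _ fun x => ?_
      have := (hφd x).hasDerivAt.tendsto_slope_zero
      have h2 : Tendsto e atTop (𝓝[≠] 0) :=
        tendsto_nhdsWithin_iff.2 ⟨etend, Eventually.of_forall fun n => (e0 n).ne'⟩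
      simpa using (this.comp h2).const_mul (h x)
  have hbound : ∀ n, -(∫ x, h x * ((e n)⁻¹ * (φ (x + e n) - φ x))) ≤ V := by
    intro n
    have i1 : Integrable (fun x => h x * φ x) := by
      simpa using hh.integrable_smul_right_of_hasCompactSupport hφ.continuous hs
    have hsh : HasCompactSupport (fun x => φ (x + e n)) :=
      hs.comp_homeomorph (Homeomorph.addRight (e n))
    have i2 : Integrable (fun x => h x * φ (x + e n)) := by
      simpa using hh.integrable_smul_right_of_hasCompactSupport
        (hφ.continuous.comp (continuous_add_const (e n))) hsh
    have e2 : ∫ x, h x * φ (x + e n) = ∫ x, h (x - e n) * φ x := by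
      rw [← integral_add_right_eq_self (fun x => h (x - e n) * φ x) (e n)]; simp
    have i3 : Integrable (fun x => h (x - e n) * φ x) := by
      simpa using i2.comp_sub_right (e n)
    have e3 : -(∫ x, h x * ((e n)⁻¹ * (φ (x + e n) - φ x))) =
        (e n)⁻¹ * ∫ x, (h x - h (x - e n)) * φ x := by
      have : ∀ x, h x * ((e n)⁻¹ * (φ (x + e n) - φ x)) =
        (e n)⁻¹ * (h x * φ (x + e n) - h x * φ x) := fun x => by ring
      simp_rw [this, integral_const_mul]
      rw [integral_sub i2 i1, e2]
      simp_rw [sub_mul]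
      rw [integral_sub i1 i3]; ring
    have hB : -B ≤ B := by simp only [B]; linarith [abs_nonneg R]
    have hTi : ∀ p q, IntervalIntegrable T volume p q := fun p q => hT.intervalIntegrable
    have hTs : ∀ p q, IntervalIntegrable (fun x => T (x - e n)) volume p q := fun p q =>
      (hT.comp (fun x y hxy => sub_le_sub_right hxy (e n))).intervalIntegrable
    have e4 : ∫ x, (h x - h (x - e n)) * φ x ≤ ∫ x in (-B)..B, (T x - T (x - e n)) := by
      rw [intervalIntegral.integral_of_le hB,
        ← setIntegral_eq_integral_of_forall_compl_eq_zero (s := Ioc (-B) B)]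
      · refine setIntegral_mono_on ?_ ?_ measurableSet_Ioc fun x _ => ?_
        · simp_rw [sub_mul]
          exact (i1.sub i3).integrableOn
        · exact ((hTi _ _).sub (hTs _ _)).1
        · have a1 := H (x - e n) trivial x trivial (by linarith [e0 n])
          calc _ ≤ |(h x - h (x - e n)) * φ x| := le_abs_self _
            _ = |h x - h (x - e n)| * |φ x| := abs_mul _ _
            _ ≤ (T x - T (x - e n)) * 1 :=
              mul_le_mul a1 (h1 x) (abs_nonneg _) ((abs_nonneg _).trans a1)
            _ = _ := mul_one _
      · intro x hx
        rw [hz x fun h' => hx ⟨?_, ?_⟩, mul_zero]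
        · simp only [B]; linarith [h'.1, le_abs_self R]
        · simp only [B]; linarith [h'.2, le_abs_self R]
    have e5 : ∫ x in (-B)..B, (T x - T (x - e n)) ≤ e n * V := by
      rw [intervalIntegral.integral_sub (hTi _ _) (hTs _ _),
        intervalIntegral.integral_comp_sub_right (fun x => T x),
        intervalIntegral.integral_interval_sub_interval_comm (hTi _ _) (hTi _ _) (hTi _ _)]
      have u1 : ∫ x in (B - e n)..B, T x ≤ ∫ x in (B - e n)..B, (a + V) :=
        intervalIntegral.integral_mono_on (by linarith [e0 n]) (hTi _ _) (by simp) fun x _ => hb x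
      have u2 : ∫ x in (-B - e n)..(-B), a ≤ ∫ x in (-B - e n)..(-B), T x :=
        intervalIntegral.integral_mono_on (by linarith [e0 n]) (by simp) (hTi _ _) fun x _ => ha x
      rw [intervalIntegral.integral_const, smul_eq_mul] at u1 u2
      rw [intervalIntegral.integral_symm (B - e n) B, intervalIntegral.integral_symm (-B - e n) (-B)]
      nlinarith
    rw [e3, inv_mul_le_iff₀ (e0 n)]
    exact e4.trans e5
  exact le_of_tendsto hlim.neg (Eventually.of_forall hbound)

/-! ### Representatives of functions of finite variation -/

/-- The terms without signs are nonnegative and telescope. This makes the test function used against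
a mollification admissible. -/
theorem abs_sum_mul_sub_le {H : ℝ → ℝ} (hH : Monotone H) (h0 : ∀ x, 0 ≤ H x) (h1 : ∀ x, H x ≤ 1)
    {σ : ℕ → ℝ} (hσ : ∀ i, |σ i| ≤ 1) {u : ℕ → ℝ} (hu : Monotone u) (n : ℕ) (t : ℝ) :
    |∑ i ∈ Finset.range n, σ i * (H (t - u i) - H (t - u (i + 1)))| ≤ 1 := by
  calc _ ≤ ∑ i ∈ Finset.range n, |σ i * (H (t - u i) - H (t - u (i + 1)))| :=
        Finset.abs_sum_le_sum_abs _ _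
    _ ≤ ∑ i ∈ Finset.range n, (H (t - u i) - H (t - u (i + 1))) := by
        refine Finset.sum_le_sum fun i _ => ?_
        have : 0 ≤ H (t - u i) - H (t - u (i + 1)) :=
          sub_nonneg.2 (hH (by linarith [hu (Nat.le_succ i)]))
        rw [abs_mul, abs_of_nonneg this]
        exact mul_le_of_le_one_left this (hσ i)
    _ = H (t - u 0) - H (t - u n) := Finset.sum_range_sub' (fun i => H (t - u i)) n
    _ ≤ 1 := by linarith [h0 (t - u n), h1 (t - u 0)]

/-- Mollification does not increase the variation. -/
theorem eVariationOn_convolution_le (ψ : ContDiffBump (0 : ℝ)) {g : ℝ → ℝ}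
    (hg : LocallyIntegrable g) :
    eVariationOn (convolution (ψ.normed volume) g (ContinuousLinearMap.lsmul ℝ ℝ) volume) univ
      ≤ variation g := by
  set ρ : ℝ → ℝ := ψ.normed volume
  set k : ℝ → ℝ := convolution ρ g (ContinuousLinearMap.lsmul ℝ ℝ) volume
  have ρc : Continuous ρ := ψ.continuous_normed
  have ρs : HasCompactSupport ρ := ψ.hasCompactSupport_normed
  have ρ0 : ∀ x, 0 ≤ ρ x := ψ.nonneg_normed
  have ρi : Integrable ρ := ψ.integrable_normed
  have ρ1 : ∫ x, ρ x = 1 := ψ.integral_normed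
  obtain ⟨R, hR⟩ := ρs.isCompact.isBounded.subset_closedBall 0
  have hz : ∀ x, x ∉ Icc (-R) R → ρ x = 0 := fun x hx => by
    by_contra hne
    have := hR (subset_tsupport _ hne)
    rw [Real.closedBall_eq_Icc] at this
    exact hx (by simpa using this)
  set H : ℝ → ℝ := fun x => ∫ t in Iic x, ρ t
  have Hm : Monotone H := fun x y hxy =>
    setIntegral_mono_set ρi.integrableOn (ae_of_all _ ρ0) (Iic_subset_Iic.2 hxy).eventuallyLE
  have H0 : ∀ x, 0 ≤ H x := fun x => integral_nonneg ρ0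
  have H1 : ∀ x, H x ≤ 1 := fun x => by
    rw [← ρ1]; exact setIntegral_le_integral ρi (ae_of_all _ ρ0)
  have Hsub : ∀ x, H x = H 0 + ∫ t in (0 : ℝ)..x, ρ t := fun x => by
    rw [← intervalIntegral.integral_Iic_sub_Iic ρi.integrableOn ρi.integrableOn]; ring
  have Hd : ∀ x, HasDerivAt H (ρ x) x := fun x => by
    rw [show H = fun x => H 0 + ∫ t in (0 : ℝ)..x, ρ t from funext Hsub]
    exact (intervalIntegral.integral_hasDerivAt_right ρi.intervalIntegrable
      (ρc.stronglyMeasurableAtFilter _ _) ρc.continuousAt).const_add _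
  have HC : ContDiff ℝ 1 H := contDiff_one_iff_deriv.2
    ⟨fun x => (Hd x).differentiableAt, by rwa [show deriv H = ρ from funext fun x => (Hd x).deriv]⟩
  have Hlo : ∀ x, x < -R → H x = 0 := fun x hx =>
    setIntegral_eq_zero_of_forall_eq_zero fun t ht => hz t fun h' => by
      linarith [h'.1, mem_Iic.1 ht]
  have Hhi : ∀ x, R < x → H x = 1 := fun x hx => by
    rw [← ρ1]
    exact setIntegral_eq_integral_of_forall_compl_eq_zero fun t ht => hz t fun h' => by
      have : x < t := not_le.1 ht
      linarith [h'.2]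
  have hk : ∀ y, ∫ t, g t * ρ (t - y) = k y := fun y => by
    simp only [k, convolution_eq_swap]
    refine integral_congr_ae (ae_of_all _ fun t => ?_)
    simp only [ContinuousLinearMap.lsmul_apply, smul_eq_mul]
    rw [mul_comm, ← neg_sub t y, show ρ (-(t - y)) = ρ (t - y) from ψ.normed_neg _]
  have gi : ∀ y, Integrable fun t => g t * ρ (t - y) := fun y => by
    simpa using hg.integrable_smul_right_of_hasCompactSupport
      (ρc.comp (continuous_sub_right y)) (ρs.comp_homeomorph (Homeomorph.subRight y))
  refine iSup_le fun ⟨n, u, hu, _⟩ => ?_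
  simp only
  set σ : ℕ → ℝ := fun i => SignType.sign (k (u (i + 1)) - k (u i))
  have hσ : ∀ i, |σ i| ≤ 1 := fun i => by
    simp only [σ]
    rcases lt_trichotomy (k (u (i + 1)) - k (u i)) 0 with h | h | h <;> simp [h]
  -- A smoothed step function equal to the sign of the `i`-th increment of `k` between `u i` and `u
  -- (i + 1)`. Testing `g` against it yields exactly the variation sum of `k` along `u`.
  set φ : ℝ → ℝ := fun t => ∑ i ∈ Finset.range n, σ i * (H (t - u i) - H (t - u (i + 1)))
  have φd : ∀ t, HasDerivAt φ (∑ i ∈ Finset.range n, σ i * (ρ (t - u i) - ρ (t - u (i + 1)))) t :=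
    fun t => HasDerivAt.fun_sum fun i _ => ((((Hd _).comp_sub_const t (u i)).sub
      ((Hd _).comp_sub_const t (u (i + 1)))).const_mul (σ i))
  have φC : ContDiff ℝ 1 φ := by
    refine ContDiff.sum fun i _ => contDiff_const.mul ((HC.comp ?_).sub (HC.comp ?_)) <;> fun_prop
  have φs : HasCompactSupport φ := by
    refine HasCompactSupport.of_support_subset_isCompact
      (isCompact_Icc (a := u 0 - R) (b := u n + R)) fun t ht => ?_
    by_contra hne
    refine ht (Finset.sum_eq_zero fun i hi => ?_)
    have hi' : i + 1 ≤ n := Finset.mem_range.1 hi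
    have a1 := hu (Nat.zero_le i)
    have a2 := hu (Nat.le_succ i)
    have a3 := hu hi'
    simp only [Nat.succ_eq_add_one] at a2
    rcases lt_or_ge t (u 0 - R) with h | h
    · rw [Hlo _ (by linarith), Hlo _ (by linarith)]; simp
    · have : u n + R < t := by
        by_contra h2; exact hne ⟨h, not_lt.1 h2⟩
      rw [Hhi _ (by linarith), Hhi _ (by linarith)]; simp
  have key : -∫ x, g x * deriv φ x = ∑ i ∈ Finset.range n, |k (u (i + 1)) - k (u i)| := by
    have e1 : ∀ x, g x * deriv φ x = ∑ i ∈ Finset.range n,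
        σ i * (g x * ρ (x - u i) - g x * ρ (x - u (i + 1))) := fun x => by
      rw [(φd x).deriv, Finset.mul_sum]
      exact Finset.sum_congr rfl fun i _ => by ring
    simp_rw [e1]
    rw [integral_finsetSum _ fun i _ => by exact ((gi _).sub (gi _)).const_mul _, ← Finset.sum_neg_distrib]
    refine Finset.sum_congr rfl fun i _ => ?_
    rw [integral_const_mul, integral_sub (gi _) (gi _), hk, hk, ← sign_mul_self]
    simp only [σ]; ring
  calc _ = ENNReal.ofReal (∑ i ∈ Finset.range n, |k (u (i + 1)) - k (u i)|) := by
        rw [ENNReal.ofReal_sum_of_nonneg fun i _ => abs_nonneg _]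
        exact Finset.sum_congr rfl fun i _ => by rw [edist_dist, Real.dist_eq]
    _ = ENNReal.ofReal (-∫ x, g x * deriv φ x) := by rw [key]
    _ ≤ variation g := le_iSup_of_le φ (le_iSup_of_le φC (le_iSup_of_le φs
        (le_iSup_of_le (abs_sum_mul_sub_le Hm H0 H1 hσ hu n) le_rfl)))

/-- Mollifications converge to `g` almost everywhere; `E` is the convergence set, and pointwise
variation is lower semicontinuous under pointwise convergence. -/
theorem exists_ae_eVariationOn_le {g : ℝ → ℝ} (hg : LocallyIntegrable g) :
    ∃ E : Set ℝ, (∀ᵐ x, x ∈ E) ∧ eVariationOn g E ≤ variation g := by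
  let ψ : ℕ → ContDiffBump (0 : ℝ) := fun n =>
    ⟨1 / ((n : ℝ) + 1), 2 * (1 / ((n : ℝ) + 1)), Nat.one_div_pos_of_nat, by
      linarith [Nat.one_div_pos_of_nat (α := ℝ) (n := n)]⟩
  have h0 : Tendsto (fun n => (ψ n).rOut) atTop (𝓝 0) := by
    have := (tendsto_one_div_add_atTop_nhds_zero_nat (𝕜 := ℝ)).const_mul 2
    rwa [mul_zero] at this
  have := ContDiffBump.ae_convolution_tendsto_right_of_locallyIntegrable h0
    (Eventually.of_forall fun n => le_refl (2 * (ψ n).rIn)) hg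
  refine ⟨_, this, ?_⟩
  by_contra hlt
  obtain ⟨n, hn⟩ := (eVariationOn.lowerSemicontinuous_aux (fun x hx => hx) (not_le.1 hlt)).exists
  exact absurd ((eVariationOn.mono _ (subset_univ _)).trans
    (eVariationOn_convolution_le (ψ n) hg)) (not_le.2 hn)

/-- Let `v x` be the variation of `g` on `E` up to `x`. On `E`, `g` is a 1-Lipschitz function of
`v`; extending that function from `v '' E` to a 1-Lipschitz `G` on `ℝ` gives `k = G ∘ v`, dominated
by `v` everywhere. -/
theorem exists_dominatedOn_extension {g : ℝ → ℝ} {E : Set ℝ} {V : ℝ}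
    (hV : eVariationOn g E ≤ ENNReal.ofReal V) (hV0 : 0 ≤ V) :
    ∃ k v : ℝ → ℝ, EqOn g k E ∧ DominatedOn k v univ ∧ (∀ x, 0 ≤ v x) ∧ ∀ x, v x ≤ V := by
  set w : ℝ → ℝ≥0∞ := fun x => eVariationOn g (E ∩ Iic x)
  have wV : ∀ x, w x ≤ ENNReal.ofReal V := fun x => (eVariationOn.mono _ inter_subset_left).trans hV
  have wt : ∀ x, w x ≠ ⊤ := fun x => ((wV x).trans_lt ENNReal.ofReal_lt_top).ne
  have wm : Monotone w := fun x y hxy =>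
    eVariationOn.mono _ (inter_subset_inter_right _ (Iic_subset_Iic.2 hxy))
  set v : ℝ → ℝ := fun x => (w x).toReal
  have vm : Monotone v := fun x y hxy => ENNReal.toReal_mono (wt y) (wm hxy)
  have hE : ∀ x ∈ E, ∀ y ∈ E, x ≤ y → |g y - g x| ≤ v y - v x := by
    intro x hx y hy hxy
    have h1 : w x + edist (g y) (g x) ≤ w y := by
      calc w x + edist (g y) (g x) ≤ w x + eVariationOn g (E ∩ Icc x y) := by
            gcongr
            exact eVariationOn.edist_le g ⟨hy, hxy, le_rfl⟩ ⟨hx, le_rfl, hxy⟩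
        _ ≤ eVariationOn g ((E ∩ Iic x) ∪ (E ∩ Icc x y)) :=
            eVariationOn.add_le_union g fun a ha b hb => ha.2.trans hb.2.1
        _ ≤ w y := eVariationOn.mono _ (union_subset
            (inter_subset_inter_right _ (Iic_subset_Iic.2 hxy))
            (inter_subset_inter_right _ fun z hz => hz.2))
    have h2 := ENNReal.toReal_mono (wt y) h1
    rw [ENNReal.toReal_add (wt x) (edist_ne_top _ _), edist_dist,
      ENNReal.toReal_ofReal dist_nonneg, Real.dist_eq] at h2
    linarith
  have hinj : ∀ x ∈ E, ∀ y ∈ E, |g x - g y| ≤ |v x - v y| := by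
    intro x hx y hy
    rcases le_total x y with h | h
    · rw [abs_sub_comm, abs_sub_comm (v x)]; exact (hE x hx y hy h).trans (le_abs_self _)
    · exact (hE y hy x hx h).trans (le_abs_self _)
  choose! c hc using fun (a : ℝ) (ha : a ∈ v '' E) => ha
  have hLip : LipschitzOnWith 1 (fun a => g (c a)) (v '' E) := by
    refine LipschitzOnWith.of_dist_le_mul fun a ha b hb => ?_
    rw [NNReal.coe_one, one_mul, Real.dist_eq, Real.dist_eq]
    have := hinj _ (hc a ha).1 _ (hc b hb).1
    rwa [(hc a ha).2, (hc b hb).2] at this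
  obtain ⟨G, hG, hGe⟩ := hLip.extend_real
  refine ⟨fun x => G (v x), v, fun x hx => ?_, fun x _ y _ hxy => ?_,
    fun x => ENNReal.toReal_nonneg, fun x => ?_⟩
  · have hm : v x ∈ v '' E := mem_image_of_mem v hx
    have h1 := hinj _ (hc _ hm).1 x hx
    rw [(hc _ hm).2, sub_self, abs_zero] at h1
    have h2 := hGe hm
    simp only at h2 ⊢
    rw [← h2]
    exact (sub_eq_zero.1 (abs_nonpos_iff.1 h1)).symm
  · have := hG.dist_le_mul (v y) (v x)
    rwa [NNReal.coe_one, one_mul, Real.dist_eq, Real.dist_eq,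
      abs_of_nonneg (sub_nonneg.2 (vm hxy))] at this
  · have := ENNReal.toReal_mono ENNReal.ofReal_ne_top (wV x)
    rwa [ENNReal.toReal_ofReal hV0] at this

/-- A function of finite variation has a representative which is controlled by a bounded
monotone function. -/
theorem exists_dominatedOn_representative {g : ℝ → ℝ} (hg : LocallyIntegrable g) {V : ℝ}
    (hV : variation g ≤ ENNReal.ofReal V) (hV0 : 0 ≤ V) :
    ∃ k v : ℝ → ℝ, g =ᵐ[volume] k ∧ DominatedOn k v univ ∧ (∀ x, 0 ≤ v x) ∧ ∀ x, v x ≤ V := by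
  obtain ⟨E, hE, hE'⟩ := exists_ae_eVariationOn_le hg
  obtain ⟨k, v, h1, h2⟩ := exists_dominatedOn_extension (hE'.trans hV) hV0
  exact ⟨k, v, hE.mono fun x hx => h1 hx, h2⟩

/-! ### Weak derivatives and primitives -/

/-- The variation of `w` is zero, so its representative is dominated by the zero function. -/
theorem ae_eq_const_of_integral_mul_deriv_eq_zero {w : ℝ → ℝ} (hw : LocallyIntegrable w)
    (h : ∀ φ : ℝ → ℝ, ContDiff ℝ 1 φ → HasCompactSupport φ → ∫ x, w x * deriv φ x = 0) :
    ∃ a : ℝ, w =ᵐ[volume] fun _ => a := by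
  have : variation w ≤ ENNReal.ofReal 0 :=
    iSup_le fun φ => iSup_le fun h1 => iSup_le fun h2 => iSup_le fun _ => by simp [h φ h1 h2]
  obtain ⟨k, v, hk, hd, h0, h1⟩ := exists_dominatedOn_representative hw this le_rfl
  have hv : ∀ x, v x = 0 := fun x => le_antisymm (h1 x) (h0 x)
  refine ⟨k 0, hk.trans (ae_of_all _ fun x => ?_)⟩
  rcases le_total 0 x with hx | hx
  · have := hd 0 trivial x trivial hx
    rw [hv, hv, sub_zero] at this
    exact sub_eq_zero.1 (abs_nonpos_iff.1 this)
  · have := hd x trivial 0 trivial hx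
    rw [hv, hv, sub_zero] at this
    exact (sub_eq_zero.1 (abs_nonpos_iff.1 this)).symm

/-- The primitive of `k` has weak derivative `k`, so it differs from `f` by a function with
vanishing weak derivative. -/
theorem HasWeakDeriv.exists_primitive {f g k v : ℝ → ℝ} (hf : HasWeakDeriv f g)
    (hk : g =ᵐ[volume] k) (hd : DominatedOn k v univ) :
    ∃ F : ℝ → ℝ, f =ᵐ[volume] F ∧ ∀ x y, F y - F x = ∫ t in x..y, k t := by
  have hv : Monotone v := monotoneOn_univ.1 hd.monotoneOn
  have ki := hd.locallyIntegrable
  have kI : ∀ a b, IntervalIntegrable k volume a b := fun a b =>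
    (ki.integrableOn_isCompact isCompact_uIcc).intervalIntegrable
  set G : ℝ → ℝ := fun x => ∫ t in (0 : ℝ)..x, k t
  have Gc : Continuous G := intervalIntegral.continuous_primitive kI 0
  have Gd : ∀ x ∉ {x | ¬ContinuousAt v x}, HasDerivAt G (k x) x := fun x hx =>
    intervalIntegral.integral_hasDerivAt_right (kI _ _)
      (ki.aestronglyMeasurable.stronglyMeasurableAtFilter)
      (hd.continuousAt (not_not.1 hx))
  have hw : LocallyIntegrable (f - G) := hf.locallyIntegrable.sub Gc.locallyIntegrable
  obtain ⟨a, ha⟩ := ae_eq_const_of_integral_mul_deriv_eq_zero hw fun φ h1 h2 => by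
    have i1 : Integrable fun x => f x * deriv φ x := by
      simpa using hf.locallyIntegrable.integrable_smul_right_of_hasCompactSupport
        (h1.continuous_deriv le_rfl) h2.deriv
    have i2 : Integrable fun x => G x * deriv φ x := by
      simpa using Gc.locallyIntegrable.integrable_smul_right_of_hasCompactSupport
        (h1.continuous_deriv le_rfl) h2.deriv
    have e1 := hf.integral_eq φ h1 h2
    have e2 := integral_mul_eq_neg_integral_mul_deriv hv.countable_not_continuousAt Gc Gd ki h1 h2
    have e3 : ∫ x, g x * φ x = ∫ x, k x * φ x :=
      integral_congr_ae (hk.mono fun x hx => by simp only [hx])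
    simp only [Pi.sub_apply, sub_mul]
    rw [integral_sub i1 i2]; linarith
  refine ⟨fun x => a + G x, ha.mono fun x hx => ?_, fun x y => ?_⟩
  · simp only [Pi.sub_apply] at hx; linarith
  · have := intervalIntegral.integral_add_adjacent_intervals (kI 0 x) (kI x y)
    simp only [G]; linarith

/-! ### Domination of averages -/

/-- By rescaling, `P x / x = ∫ u in 0..1, p (x * u)`, a mean of dilates of `p`; it is dominated by
the same mean of dilates of `v`. -/
theorem DominatedOn.exists_average {p v P : ℝ → ℝ} {V : ℝ} (hd : DominatedOn p v univ)
    (h0 : ∀ x, 0 ≤ v x) (h1 : ∀ x, v x ≤ V) (hP : ∀ x, P x = ∫ t in (0 : ℝ)..x, p t) :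
    ∃ T : ℝ → ℝ, Monotone T ∧ (∀ x, 0 ≤ T x) ∧ (∀ x, T x ≤ V) ∧
      DominatedOn (fun x => P x / x) T (Ioi 0) := by
  have hv : Monotone v := monotoneOn_univ.1 hd.monotoneOn
  have hu : Monotone fun x => v x - p x := monotoneOn_univ.1 hd.monotoneOn_sub
  have vi : ∀ x, IntervalIntegrable (fun u => v (x * u)) volume 0 1 := fun x => by
    rcases le_total 0 x with hx | hx
    · exact (hv.comp (monotone_mul_left_of_nonneg hx)).intervalIntegrable
    · exact (hv.comp_antitone (antitone_mul_left hx)).intervalIntegrable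
  have pi : ∀ x, 0 < x → IntervalIntegrable (fun u => p (x * u)) volume 0 1 := fun x hx => by
    have := (vi x).sub (hu.comp (monotone_mul_left_of_nonneg hx.le)).intervalIntegrable
    refine this.congr fun u _ => ?_
    simp
  have e : ∀ x, 0 < x → P x / x = ∫ u in (0 : ℝ)..1, p (x * u) := fun x hx => by
    rw [intervalIntegral.integral_comp_mul_left _ hx.ne', hP]
    simp [div_eq_inv_mul]
  refine ⟨fun x => ∫ u in (0 : ℝ)..1, v (x * u), fun x y hxy => ?_, fun x => ?_, fun x => ?_, ?_⟩
  · exact intervalIntegral.integral_mono_on zero_le_one (vi x) (vi y) fun u hu =>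
      hv (mul_le_mul_of_nonneg_right hxy hu.1)
  · exact intervalIntegral.integral_nonneg zero_le_one fun u _ => h0 _
  · have := intervalIntegral.integral_mono_on zero_le_one (vi x)
      (intervalIntegrable_const (c := V)) fun u _ => h1 (x * u)
    simpa using this
  · intro x hx y hy hxy
    simp only
    rw [e x hx, e y hy, ← intervalIntegral.integral_sub (pi y hy) (pi x hx),
      ← intervalIntegral.integral_sub (vi y) (vi x)]
    rw [← Real.norm_eq_abs]
    refine intervalIntegral.norm_integral_le_of_norm_le zero_le_one
      (ae_of_all _ fun u hu => ?_) ((vi y).sub (vi x))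
    exact hd _ trivial _ trivial (mul_le_mul_of_nonneg_right hxy hu.1.le)

/-- After rescaling, the quotient is the integral over `u` in `[0, 1]` of `P (x * u) / (x * u)` with
weight `u`. -/
theorem DominatedOn.exists_average_average {P T : ℝ → ℝ} {V : ℝ} (hP : Continuous P)
    (hT : Monotone T) (h0 : ∀ x, 0 ≤ T x) (h1 : ∀ x, T x ≤ V)
    (hd : DominatedOn (fun x => P x / x) T (Ioi 0)) :
    ∃ S : ℝ → ℝ, (∀ x, 0 ≤ S x) ∧ (∀ x, S x ≤ V) ∧
      DominatedOn (fun x => (∫ t in (0 : ℝ)..x, P t) / x ^ 2) S (Ioi 0) := by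
  have ti : ∀ x, IntervalIntegrable (fun u => u * T (x * u)) volume 0 1 := fun x => by
    refine IntervalIntegrable.continuousOn_mul ?_ continuousOn_id
    rcases le_total 0 x with hx | hx
    · exact (hT.comp (monotone_mul_left_of_nonneg hx)).intervalIntegrable
    · exact (hT.comp_antitone (antitone_mul_left hx)).intervalIntegrable
  have pi : ∀ x : ℝ, IntervalIntegrable (fun u => P (x * u) / x) volume 0 1 := fun x =>
    (by fun_prop : Continuous fun u => P (x * u) / x).intervalIntegrable _ _
  have e : ∀ x, 0 < x → (∫ t in (0 : ℝ)..x, P t) / x ^ 2 = ∫ u in (0 : ℝ)..1, P (x * u) / x :=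
    fun x hx => by
    rw [intervalIntegral.integral_div, intervalIntegral.integral_comp_mul_left _ hx.ne']
    simp only [mul_zero, mul_one, smul_eq_mul]
    field_simp
  refine ⟨fun x => ∫ u in (0 : ℝ)..1, u * T (x * u), fun x => ?_, fun x => ?_, ?_⟩
  · exact intervalIntegral.integral_nonneg zero_le_one fun u hu => mul_nonneg hu.1 (h0 _)
  · have := intervalIntegral.integral_mono_on zero_le_one (ti x)
      (intervalIntegrable_const (c := V)) fun u hu =>
        (mul_le_of_le_one_left (h0 _) hu.2).trans (h1 (x * u))
    simpa using this
  · intro x hx y hy hxy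
    simp only
    rw [e x hx, e y hy, ← intervalIntegral.integral_sub (pi y) (pi x),
      ← intervalIntegral.integral_sub (ti y) (ti x)]
    rw [← Real.norm_eq_abs]
    refine intervalIntegral.norm_integral_le_of_norm_le zero_le_one
      (ae_of_all _ fun u hu => ?_) ((ti y).sub (ti x))
    have hx' : 0 < x := hx
    have hy' : 0 < y := hy
    have hu0 : 0 < u := hu.1
    have := hd (x * u) (mul_pos hx hu0) (y * u) (mul_pos hy hu0)
      (mul_le_mul_of_nonneg_right hxy hu0.le)
    simp only at this
    have e1 : P (y * u) / y - P (x * u) / x = u * (P (y * u) / (y * u) - P (x * u) / (x * u)) := by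
      field_simp
    rw [e1, norm_mul, Real.norm_eq_abs, Real.norm_eq_abs, abs_of_pos hu0, ← mul_sub]
    exact mul_le_mul_of_nonneg_left this hu0.le

/-- The minimizer may be `0`, where the quotients by `s` take the default value `0`. The dominator
gets the value `-V` there, and the resulting jump of at least `V` pays for the jump of `h`. -/
theorem DominatedOn.exists_Ici {h T : ℝ → ℝ} {V : ℝ} (hd : DominatedOn h T (Ioi 0))
    (hz : h 0 = 0) (h0 : ∀ x, 0 < x → 0 ≤ h x) (h1 : ∀ x, 0 < x → h x ≤ V)
    (T0 : ∀ x, 0 ≤ T x) (T1 : ∀ x, T x ≤ V) :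
    ∃ S : ℝ → ℝ, (∀ x, -V ≤ S x) ∧ (∀ x, S x ≤ V) ∧ DominatedOn h S (Ici 0) := by
  have hV : 0 ≤ V := (T0 0).trans (T1 0)
  refine ⟨fun x => if x ≤ 0 then -V else T x, fun x => ?_, fun x => ?_, fun x hx y hy hxy => ?_⟩
  · simp only; split_ifs
    · exact le_rfl
    · linarith [T0 x]
  · simp only; split_ifs
    · linarith
    · exact T1 x
  · rcases eq_or_lt_of_le (mem_Ici.1 hx) with rfl | hx'
    · rcases eq_or_lt_of_le (mem_Ici.1 hy) with rfl | hy'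
      · simp
      · simp only [le_refl, if_true, if_neg (not_le.2 hy'), hz, sub_zero]
        rw [abs_of_nonneg (h0 y hy')]
        linarith [T0 y, h1 y hy']
    · have hy' := hx'.trans_le hxy
      simp only [if_neg (not_le.2 hx'), if_neg (not_le.2 hy')]
      exact hd x hx' y hy' hxy

/-! ### The increment estimate for the slope -/

/-- Increments of `T` add up, so an estimate between points of comparable size can be chained
dyadically without loss. -/
theorem DominatedOn.of_le_two_mul {h T : ℝ → ℝ}
    (H : ∀ x y, 0 < x → x ≤ y → y ≤ 2 * x → |h y - h x| ≤ T y - T x) :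
    DominatedOn h T (Ioi 0) := by
  have key : ∀ n : ℕ, ∀ x y, 0 < x → x ≤ y → y ≤ 2 ^ n * x → |h y - h x| ≤ T y - T x := by
    intro n
    induction n with
    | zero => intro x y hx hxy hy; exact H x y hx hxy (by linarith)
    | succ n ih =>
      intro x y hx hxy hy
      rcases le_total (y / 2) x with h2 | h2
      · exact H x y hx hxy (by linarith)
      · have a1 := ih x (y / 2) hx h2 (by rw [pow_succ] at hy; linarith)
        have a2 := H (y / 2) y (by linarith) (by linarith) (by linarith)
        have := abs_sub_le (h y) (h (y / 2)) (h x)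
        linarith
  intro x hx y hy hxy
  obtain ⟨n, hn⟩ := pow_unbounded_of_one_lt (y / x) one_lt_two
  exact key n x y hx hxy ((div_lt_iff₀ hx).1 hn).le

/-- The slope changes through `α` and `γ`, which is harmless, and through `r`, at cost `(α + γ) *
|r' - r|`. Subtracting the two quadratic relations bounds `γ * |r' - r|` by `E`. The term `α * |r' -
r|` is the signed increment, which telescopes through `α * r`, plus twice `α * δ` for the downward
movement `δ` of `r`. -/
theorem abs_slope_sub_le {α α' β β' γ γ' κ κ' r r' c x x' : ℝ}
    (hx : 0 < x) (hxx : x < x') (hx2 : x' ≤ 2 * x)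
    (hα : 0 ≤ α) (hβ : 0 ≤ β) (hγ : 0 ≤ γ) (hκ : 0 ≤ κ)
    (hr : 0 ≤ r) (hr' : 0 ≤ r') (hrc : r ≤ c) (hrc' : r' ≤ c) (hκγ : κ ≤ γ)
    (e : γ * r + κ * r ^ 2 = β) (e' : γ' * r' + κ' * r' ^ 2 = β')
    (hmono : x * r ≤ x' * r') (hint : α * x * (x' - x) ≤ β' * x' ^ 2 - β * x ^ 2) :
    |(α' - r' * γ') / (1 + r') - (α - r * γ) / (1 + r)| ≤
      (α' * r' - α * r) + (1 + c) * |α' - α| + |γ' - γ| +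
      (1 + 6 * (c + c ^ 2)) * (|β' - β| + c ^ 2 * |κ' - κ| + c * |γ' - γ|) + 4 * c * |β' - β| := by
  have hc : 0 ≤ c := hr.trans hrc
  set E := |β' - β| + c ^ 2 * |κ' - κ| + c * |γ' - γ| with hE
  have s1 : γ * |r' - r| ≤ E := by
    have id1 : (γ + κ * (r + r')) * (r' - r) = (β' - β) - r' ^ 2 * (κ' - κ) - r' * (γ' - γ) := by
      rw [← e, ← e']; ring
    have hg : γ ≤ γ + κ * (r + r') := by
      have : 0 ≤ κ * (r + r') := by positivity
      linarith
    calc γ * |r' - r| ≤ (γ + κ * (r + r')) * |r' - r| :=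
          mul_le_mul_of_nonneg_right hg (abs_nonneg _)
      _ = |(β' - β) - r' ^ 2 * (κ' - κ) - r' * (γ' - γ)| := by
          rw [← id1, abs_mul, abs_of_nonneg (hγ.trans hg)]
      _ ≤ |β' - β| + |r' ^ 2 * (κ' - κ)| + |r' * (γ' - γ)| :=
          (abs_sub _ _).trans (add_le_add_left (abs_sub _ _) _)
      _ ≤ E := by
          rw [abs_mul, abs_mul, abs_of_nonneg hr', abs_of_nonneg (sq_nonneg r')]
          simp only [hE]
          gcongr
  set δ := max 0 (r - r') with hδ
  have δ0 : 0 ≤ δ := le_max_left _ _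
  have δabs : |r' - r| = (r' - r) + 2 * δ := by
    rcases le_total r r' with h | h
    · rw [abs_of_nonneg (sub_nonneg.2 h), hδ, max_eq_left (by linarith)]; ring
    · rw [abs_of_nonpos (by linarith), hδ, max_eq_right (by linarith)]; ring
  have δle : δ ≤ |r' - r| := by
    rw [hδ]; exact max_le (abs_nonneg _) (by rw [abs_sub_comm]; exact le_abs_self _)
  -- Since `x * r` is nondecreasing, `r` can fall only as fast as `x` grows.
  have δr : δ * x' ≤ r * (x' - x) := by
    rcases le_total r r' with h | h
    · rw [hδ, max_eq_left (by linarith), zero_mul]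
      exact mul_nonneg hr (by linarith)
    · rw [hδ, max_eq_right (by linarith)]; linarith
  have βle : β ≤ (c + c ^ 2) * γ := by
    rw [← e]
    have h1 : γ * r ≤ γ * c := by gcongr
    have h2 : κ * r ^ 2 ≤ γ * c ^ 2 := by gcongr
    linarith
  have βδ : β * δ ≤ (c + c ^ 2) * E := by
    calc β * δ ≤ ((c + c ^ 2) * γ) * |r' - r| := by gcongr
      _ = (c + c ^ 2) * (γ * |r' - r|) := by ring
      _ ≤ _ := by gcongr
  -- Multiply `hint`, the growth of `β * x ^ 2`, by `δ`. The change of `β` is tamed by `δr`, and the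
  -- rest is `β * δ`, which `βδ` bounds by `E`; `x' ≤ 2 * x` gives the factors 2 and 3.
  have αδ : α * δ ≤ 2 * c * |β' - β| + 3 * (β * δ) := by
    have hd : 0 < x' - x := by linarith
    have hpos : 0 < x * (x' - x) := mul_pos hx hd
    refine le_of_mul_le_mul_right ?_ hpos
    have t1 : α * x * (x' - x) * δ ≤ (β' * x' ^ 2 - β * x ^ 2) * δ :=
      mul_le_mul_of_nonneg_right hint δ0
    have t2 : (β' - β) * (x' * (δ * x')) ≤ |β' - β| * ((2 * x) * (c * (x' - x))) := by
      have : 0 ≤ x' * (δ * x') := by have := hx.trans hxx; positivity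
      calc _ ≤ |β' - β| * (x' * (δ * x')) := mul_le_mul_of_nonneg_right (le_abs_self _) this
        _ ≤ _ := by
          have h3 : δ * x' ≤ c * (x' - x) :=
            δr.trans (mul_le_mul_of_nonneg_right hrc hd.le)
          have : 0 ≤ δ * x' := mul_nonneg δ0 (hx.trans hxx).le
          gcongr
    have t3 : β * δ * ((x' - x) * (x' + x)) ≤ β * δ * ((x' - x) * (3 * x)) := by
      gcongr; linarith
    have i1 : (β' * x' ^ 2 - β * x ^ 2) * δ =
        (β' - β) * (x' * (δ * x')) + β * δ * ((x' - x) * (x' + x)) := by ring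
    calc α * δ * (x * (x' - x)) = α * x * (x' - x) * δ := by ring
      _ ≤ |β' - β| * ((2 * x) * (c * (x' - x))) + β * δ * ((x' - x) * (3 * x)) := by linarith
      _ = _ := by ring
  have s2 : α * |r' - r| ≤ (α' * r' - α * r) + c * |α' - α| + 4 * c * |β' - β| +
      6 * ((c + c ^ 2) * E) := by
    have h1 : r' * (α - α') ≤ c * |α' - α| := by
      rw [abs_sub_comm]
      exact (mul_le_mul_of_nonneg_left (le_abs_self _) hr').trans
        (mul_le_mul_of_nonneg_right hrc' (abs_nonneg _))
    have i1 : α * ((r' - r) + 2 * δ) =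
        (α' * r' - α * r) + r' * (α - α') + 2 * (α * δ) := by ring
    rw [δabs, i1]; linarith
  have hθ : ∀ a : ℝ, 0 ≤ a → (1 + a)⁻¹ ≤ 1 := fun a ha => inv_le_one_of_one_le₀ (by linarith)
  have id2 : (α' - r' * γ') / (1 + r') - (α - r * γ) / (1 + r) =
      (1 + r')⁻¹ * (α' - α) - (1 - (1 + r')⁻¹) * (γ' - γ) -
        ((1 + r)⁻¹ * (1 + r')⁻¹) * ((α + γ) * (r' - r)) := by
    field_simp; ring
  have n1 : |(1 + r')⁻¹ * (α' - α)| ≤ |α' - α| := by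
    rw [abs_mul, abs_of_nonneg (by positivity)]
    exact mul_le_of_le_one_left (abs_nonneg _) (hθ _ hr')
  have n2 : |(1 - (1 + r')⁻¹) * (γ' - γ)| ≤ |γ' - γ| := by
    have : 0 ≤ (1 + r')⁻¹ := by positivity
    rw [abs_mul, abs_of_nonneg (by linarith [hθ _ hr'])]
    exact mul_le_of_le_one_left (abs_nonneg _) (by linarith)
  have n3 : |((1 + r)⁻¹ * (1 + r')⁻¹) * ((α + γ) * (r' - r))| ≤ (α + γ) * |r' - r| := by
    rw [abs_mul, abs_mul (α + γ), abs_of_nonneg (by positivity : 0 ≤ (1 + r)⁻¹ * (1 + r')⁻¹),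
      abs_of_nonneg (add_nonneg hα hγ)]
    exact mul_le_of_le_one_left (by positivity)
      (mul_le_one₀ (hθ _ hr) (by positivity) (hθ _ hr'))
  rw [id2]
  have := (abs_sub ((1 + r')⁻¹ * (α' - α) - (1 - (1 + r')⁻¹) * (γ' - γ))
    (((1 + r)⁻¹ * (1 + r')⁻¹) * ((α + γ) * (r' - r)))).trans
      (add_le_add_left (abs_sub _ _) _)
  have i1 : (1 + 6 * (c + c ^ 2)) * E = E + 6 * ((c + c ^ 2) * E) := by ring
  have i2 : (α + γ) * |r' - r| = α * |r' - r| + γ * |r' - r| := by ring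
  linarith

/-! ### The minimization problem on a half-line -/

/-- `M` is, on the right half-line, the infimum over `s ≥ 0` of the averages over `[-s, x]` of the
function which is `P` on the right and the reflection of `Q` on the left, and the infimum is
attained for some `s ≤ c * x`. -/
structure IsHalfLineInf (c : ℝ) (P Q M : ℝ → ℝ) : Prop where
  contP : Continuous P
  contQ : Continuous Q
  monoP : MonotoneOn P (Ici 0)
  monoQ : MonotoneOn Q (Ici 0)
  zeroP : P 0 = 0
  zeroQ : Q 0 = 0
  le_P : ∀ x, 0 < x → M x ≤ P x
  le_average : ∀ x s, 0 < x → 0 ≤ s →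
    M x * (s + x) ≤ (∫ t in (0 : ℝ)..s, Q t) + ∫ t in (0 : ℝ)..x, P t
  exists_eq : ∀ x, 0 < x → ∃ s, 0 ≤ s ∧ s ≤ c * x ∧ Q s = M x ∧
    M x * (s + x) = (∫ t in (0 : ℝ)..s, Q t) + ∫ t in (0 : ℝ)..x, P t

namespace IsHalfLineInf

variable {c V : ℝ} {P Q M : ℝ → ℝ}

theorem integral_sub_integral (h : Continuous P) (x y : ℝ) :
    (∫ t in (0 : ℝ)..y, P t) - ∫ t in (0 : ℝ)..x, P t = ∫ t in x..y, P t :=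
  intervalIntegral.integral_interval_sub_left (h.intervalIntegrable _ _) (h.intervalIntegrable _ _)

theorem integral_le (h : Continuous P) (hm : MonotoneOn P (Ici 0)) {x y : ℝ} (hx : 0 ≤ x)
    (hxy : x ≤ y) : ∫ t in x..y, P t ≤ P y * (y - x) := by
  have := intervalIntegral.integral_mono_on hxy (h.intervalIntegrable x y)
    (intervalIntegrable_const (μ := volume) (c := P y)) fun t ht =>
      hm (hx.trans ht.1) (hx.trans hxy) ht.2
  rw [intervalIntegral.integral_const, smul_eq_mul] at this
  linarith

theorem le_integral (h : Continuous P) (hm : MonotoneOn P (Ici 0)) {x y : ℝ} (hx : 0 ≤ x)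
    (hxy : x ≤ y) : P x * (y - x) ≤ ∫ t in x..y, P t := by
  have := intervalIntegral.integral_mono_on hxy (intervalIntegrable_const (μ := volume) (c := P x))
    (h.intervalIntegrable x y) fun t ht => hm hx (hx.trans ht.1) ht.1
  rw [intervalIntegral.integral_const, smul_eq_mul] at this
  linarith

/-- Select the least minimizer. If `x ≤ y` but `s y < s x`, then `M y ≤ M x ≤ P x`, so removing `[x,
y]` from the optimal interval of `y` does not raise its average. Hence `s y` is also optimal for
`x`, contradicting minimality of `s x`. -/
theorem exists_monotone_selection (h : IsHalfLineInf c P Q M) :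
    ∃ s : ℝ → ℝ, MonotoneOn s (Ioi 0) ∧ ∀ x, 0 < x → 0 ≤ s x ∧ s x ≤ c * x ∧ Q (s x) = M x ∧
      M x * (s x + x) = (∫ t in (0 : ℝ)..s x, Q t) + ∫ t in (0 : ℝ)..x, P t := by
  set I : ℝ → ℝ := fun s => ∫ t in (0 : ℝ)..s, Q t
  set J : ℝ → ℝ := fun x => ∫ t in (0 : ℝ)..x, P t
  have Ic : Continuous I := intervalIntegral.continuous_primitive
    (fun a b => h.contQ.intervalIntegrable a b) 0
  have hmin : ∀ x, 0 < x → ∃ s, (0 ≤ s ∧ s ≤ c * x ∧ Q s = M x ∧ M x * (s + x) = I s + J x) ∧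
      ∀ s', 0 ≤ s' → Q s' = M x → M x * (s' + x) = I s' + J x → s ≤ s' := by
    intro x hx
    have hQ := h.contQ
    have hcl : IsClosed {s | Q s = M x ∧ M x * (s + x) = I s + J x} :=
      (isClosed_eq hQ continuous_const).inter (isClosed_eq (by fun_prop) (by fun_prop))
    have hcpt : IsCompact (Icc 0 (c * x) ∩ {s | Q s = M x ∧ M x * (s + x) = I s + J x}) :=
      isCompact_Icc.inter_right hcl
    obtain ⟨s0, a1, a2, a3, a4⟩ := h.exists_eq x hx
    obtain ⟨s, hs, hs'⟩ := hcpt.exists_isLeast ⟨s0, ⟨a1, a2⟩, a3, a4⟩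
    refine ⟨s, ⟨hs.1.1, hs.1.2, hs.2.1, hs.2.2⟩, fun s' b1 b2 b3 => ?_⟩
    by_contra hlt
    exact hlt (hs' ⟨⟨b1, (not_le.1 hlt).le.trans hs.1.2⟩, b2, b3⟩)
  choose! s hs hs' using hmin
  refine ⟨s, fun x hx y hy hxy => ?_, hs⟩
  obtain ⟨a1, a2, a3, a4⟩ := hs x hx
  obtain ⟨b1, b2, b3, b4⟩ := hs y hy
  by_contra hlt
  have hlt := not_le.1 hlt
  have q : Q (s y) ≤ Q (s x) := h.monoQ b1 a1 hlt.le
  have d1 : J y - J x = ∫ t in x..y, P t := integral_sub_integral h.contP x y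
  have d3 := le_integral h.contP h.monoP (le_of_lt hx) hxy
  have d5 := h.le_average x (s y) hx b1
  have d6 := h.le_P x hx
  have hMP : M y * (y - x) ≤ P x * (y - x) := mul_le_mul_of_nonneg_right
    (by linarith) (by linarith)
  have g : I (s y) + J x ≤ M y * (s y + x) := by linarith
  have hMM : M x ≤ M y :=
    le_of_mul_le_mul_right (d5.trans g) (by linarith [mem_Ioi.1 hx])
  have hMe : M y = M x := le_antisymm (by linarith) hMM
  have hMx : M x * (s y + x) = I (s y) + J x := le_antisymm d5 (by rwa [hMe] at g)
  exact absurd (hs' x hx (s y) b1 (by linarith) hMx) (not_le.2 hlt)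

section Selection

variable {s : ℝ → ℝ}

/-- The minimizer of `x` serves as competitor at `y`; this is one half of the envelope argument. -/
theorem sub_mul_le (h : IsHalfLineInf c P Q M)
    (hs : ∀ x, 0 < x → 0 ≤ s x ∧ s x ≤ c * x ∧ Q (s x) = M x ∧
      M x * (s x + x) = (∫ t in (0 : ℝ)..s x, Q t) + ∫ t in (0 : ℝ)..x, P t)
    {x y : ℝ} (hx : 0 < x) (hxy : x ≤ y) :
    (M y - M x) * (s x + y) ≤ (P y - M x) * (y - x) := by
  have a4 := (hs x hx).2.2.2
  have d := h.le_average y (s x) (hx.trans_le hxy) (hs x hx).1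
  have d1 := integral_sub_integral h.contP x y
  have d3 := integral_le h.contP h.monoP hx.le hxy
  linarith

/-- The other half: the minimizer of `y` serves as competitor at `x`. -/
theorem le_sub_mul (h : IsHalfLineInf c P Q M)
    (hs : ∀ x, 0 < x → 0 ≤ s x ∧ s x ≤ c * x ∧ Q (s x) = M x ∧
      M x * (s x + x) = (∫ t in (0 : ℝ)..s x, Q t) + ∫ t in (0 : ℝ)..x, P t)
    {x y : ℝ} (hx : 0 < x) (hxy : x ≤ y) :
    (P x - M y) * (y - x) ≤ (M y - M x) * (s y + x) := by
  have hy := hx.trans_le hxy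
  have a4 := (hs y hy).2.2.2
  have d := h.le_average x (s y) hx (hs y hy).1
  have d1 := integral_sub_integral h.contP x y
  have d3 := le_integral h.contP h.monoP hx.le hxy
  linarith

/-- `M` is nondecreasing because `Q` and `s` are, and `sub_mul_le` with `P y ≤ V * y` makes it
`V`-Lipschitz. -/
theorem continuousOn (h : IsHalfLineInf c P Q M) (hPV : ∀ x, 0 < x → P x / x ≤ V)
    (hm : MonotoneOn s (Ioi 0))
    (hs : ∀ x, 0 < x → 0 ≤ s x ∧ s x ≤ c * x ∧ Q (s x) = M x ∧
      M x * (s x + x) = (∫ t in (0 : ℝ)..s x, Q t) + ∫ t in (0 : ℝ)..x, P t) :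
    ContinuousOn M (Ioi 0) := by
  have M0 : ∀ x, 0 < x → 0 ≤ M x := fun x hx => by
    rw [← (hs x hx).2.2.1, ← h.zeroQ]
    exact h.monoQ self_mem_Ici (hs x hx).1 (hs x hx).1
  have hMm : ∀ x y, 0 < x → x ≤ y → M x ≤ M y := fun x y hx hxy => by
    have hy := hx.trans_le hxy
    rw [← (hs x hx).2.2.1, ← (hs y hy).2.2.1]
    exact h.monoQ (hs x hx).1 (hs y hy).1 (hm hx hy hxy)
  have hML : ∀ x y, 0 < x → x ≤ y → M y - M x ≤ V * (y - x) := fun x y hx hxy => by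
    have hy := hx.trans_le hxy
    have d := h.sub_mul_le hs hx hxy
    have p := (div_le_iff₀ hy).1 (hPV y hy)
    have d1 : (M y - M x) * y ≤ (M y - M x) * (s x + y) :=
      mul_le_mul_of_nonneg_left (by linarith [(hs x hx).1]) (by linarith [hMm x y hx hxy])
    have d2 : (P y - M x) * (y - x) ≤ (V * y) * (y - x) :=
      mul_le_mul_of_nonneg_right (by linarith [M0 x hx]) (by linarith)
    refine le_of_mul_le_mul_right ?_ hy
    linarith
  have hV : 0 ≤ V := by
    have := hML 1 2 one_pos one_le_two
    have := hMm 1 2 one_pos one_le_two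
    linarith
  refine (LipschitzOnWith.of_dist_le_mul (K := V.toNNReal) fun x hx y hy => ?_).continuousOn
  rw [Real.dist_eq, Real.dist_eq, Real.coe_toNNReal V hV]
  rcases le_total x y with hxy | hxy
  · rw [abs_sub_comm, abs_sub_comm x, abs_of_nonneg (by linarith [hMm x y hx hxy]),
      abs_of_nonneg (sub_nonneg.2 hxy)]
    exact hML x y hx hxy
  · rw [abs_of_nonneg (by linarith [hMm y x hy hxy]), abs_of_nonneg (sub_nonneg.2 hxy)]
    exact hML y x hy hxy

theorem hasDerivAt (h : IsHalfLineInf c P Q M) (hM : ContinuousOn M (Ioi 0))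
    (hs : ∀ x, 0 < x → 0 ≤ s x ∧ s x ≤ c * x ∧ Q (s x) = M x ∧
      M x * (s x + x) = (∫ t in (0 : ℝ)..s x, Q t) + ∫ t in (0 : ℝ)..x, P t)
    {x : ℝ} (hx : 0 < x) (hsx : ContinuousAt s x) :
    HasDerivAt M ((P x - M x) / (x + s x)) x := by
  have hMc : Tendsto M (𝓝 x) (𝓝 (M x)) := hM.continuousAt (Ioi_mem_nhds hx)
  have hPc : Tendsto P (𝓝 x) (𝓝 (P x)) := h.contP.continuousAt
  have hne : x + s x ≠ 0 := by linarith [(hs x hx).1]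
  have lA : Tendsto (fun y => (P x - M y) / (x + s y)) (𝓝 x) (𝓝 ((P x - M x) / (x + s x))) :=
    (hMc.const_sub _).div (hsx.tendsto.const_add x) hne
  have lB : Tendsto (fun y => (P y - M x) / (y + s x)) (𝓝 x) (𝓝 ((P x - M x) / (x + s x))) :=
    (hPc.sub_const _).div (tendsto_id.add_const (s x)) hne
  -- The two competitor bounds exchange roles with the sign of `y - x`; their minimum and maximum
  -- cover both sides at once.
  have lmin := lA.min lB
  have lmax := lA.max lB
  rw [min_self] at lmin
  rw [max_self] at lmax
  rw [hasDerivAt_iff_tendsto_slope]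
  have hpos : ∀ᶠ y in 𝓝[≠] x, 0 < y ∧ y ≠ x :=
    (eventually_nhdsWithin_of_eventually_nhds (Ioi_mem_nhds hx)).and self_mem_nhdsWithin
  have key : ∀ y, 0 < y → y ≠ x →
      min ((P x - M y) / (x + s y)) ((P y - M x) / (y + s x)) ≤ slope M x y ∧
      slope M x y ≤ max ((P x - M y) / (x + s y)) ((P y - M x) / (y + s x)) := by
    intro y hy hyx
    rw [slope_def_field]
    have p1 : 0 < x + s y := by linarith [(hs y hy).1]
    have p2 : 0 < y + s x := by linarith [(hs x hx).1]
    rcases lt_or_gt_of_ne hyx with hlt | hlt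
    · have d1 := h.sub_mul_le hs hy hlt.le
      have d2 := h.le_sub_mul hs hy hlt.le
      have e : (M y - M x) / (y - x) = (M x - M y) / (x - y) := by
        rw [← neg_sub (M x), ← neg_sub x, neg_div_neg_eq]
      rw [e]
      have p3 : 0 < x - y := by linarith
      refine ⟨min_le_of_right_le ?_, le_max_of_le_left ?_⟩
      · rw [div_le_div_iff₀ p2 p3]; linarith
      · rw [div_le_div_iff₀ p3 p1]; linarith
    · have d1 := h.sub_mul_le hs hx hlt.le
      have d2 := h.le_sub_mul hs hx hlt.le
      have p3 : 0 < y - x := by linarith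
      refine ⟨min_le_of_left_le ?_, le_max_of_le_right ?_⟩
      · rw [div_le_div_iff₀ p1 p3]; linarith
      · rw [div_le_div_iff₀ p3 p2]; linarith
  exact tendsto_of_tendsto_of_tendsto_of_le_of_le'
    (lmin.mono_left nhdsWithin_le_nhds) (lmax.mono_left nhdsWithin_le_nhds)
    (hpos.mono fun y hy => (key y hy.1 hy.2).1) (hpos.mono fun y hy => (key y hy.1 hy.2).2)

/-- Applies `abs_slope_sub_le` and replaces each increment on its right-hand side by that of a
dominator. Dominators of `γ` and `η` are evaluated at `s x`, which is legitimate because `s` is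
monotone. -/
theorem exists_dominatedOn (h : IsHalfLineInf c P Q M) (hc : 0 < c)
    (hPV : ∀ x, 0 < x → P x / x ≤ V) (hQV : ∀ x, 0 < x → Q x / x ≤ V)
    {A B : ℝ → ℝ} (Am : Monotone A) (A0 : ∀ x, 0 ≤ A x) (A1 : ∀ x, A x ≤ V)
    (hA : DominatedOn (fun x => P x / x) A (Ioi 0))
    (Bm : Monotone B) (B0 : ∀ x, 0 ≤ B x) (B1 : ∀ x, B x ≤ V)
    (hB : DominatedOn (fun x => Q x / x) B (Ioi 0))
    (hm : MonotoneOn s (Ioi 0))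
    (hs : ∀ x, 0 < x → 0 ≤ s x ∧ s x ≤ c * x ∧ Q (s x) = M x ∧
      M x * (s x + x) = (∫ t in (0 : ℝ)..s x, Q t) + ∫ t in (0 : ℝ)..x, P t) :
    ∃ T : ℝ → ℝ, (∀ x, 0 < x → |T x| ≤ (30 * (1 + c) ^ 4) * V) ∧
      DominatedOn (fun x => (P x - M x) / (x + s x)) T (Ioi 0) := by
  set I : ℝ → ℝ := fun s => ∫ t in (0 : ℝ)..s, Q t
  set J : ℝ → ℝ := fun x => ∫ t in (0 : ℝ)..x, P t
  have hV : 0 ≤ V := (A0 0).trans (A1 0)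
  have P0 : ∀ x, 0 ≤ x → 0 ≤ P x := fun x hx => by
    rw [← h.zeroP]; exact h.monoP self_mem_Ici hx hx
  have Q0 : ∀ x, 0 ≤ x → 0 ≤ Q x := fun x hx => by
    rw [← h.zeroQ]; exact h.monoQ self_mem_Ici hx hx
  have I0 : ∀ x, 0 ≤ x → 0 ≤ I x := fun x hx =>
    intervalIntegral.integral_nonneg hx fun t ht => Q0 t ht.1
  have I1 : ∀ x, 0 ≤ x → I x ≤ Q x * x := fun x hx => by
    simpa using integral_le h.contQ h.monoQ le_rfl hx
  have J0 : ∀ x, 0 ≤ x → 0 ≤ J x := fun x hx =>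
    intervalIntegral.integral_nonneg hx fun t ht => P0 t ht.1
  obtain ⟨A', A'0, A'1, hA'⟩ := hA.exists_average_average h.contP Am A0 A1
  obtain ⟨B', B'0, B'1, hB'⟩ := hB.exists_average_average h.contQ Bm B0 B1
  obtain ⟨C, C0, C1, hC⟩ := hB.exists_Ici (by simp)
    (fun x hx => div_nonneg (Q0 x hx.le) hx.le) hQV B0 B1
  obtain ⟨C', C'0, C'1, hC'⟩ := hB'.exists_Ici (by simp)
    (fun x hx => div_nonneg (I0 x hx.le) (sq_nonneg x)) (fun x hx => by
      refine le_trans ?_ (hQV x hx)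
      rw [div_le_div_iff₀ (by positivity) hx]
      nlinarith [I1 x hx.le]) B'0 B'1
  set α : ℝ → ℝ := fun x => P x / x with hα
  set β : ℝ → ℝ := fun x => J x / x ^ 2 with hβ
  set γ : ℝ → ℝ := fun x => Q (s x) / s x with hγ
  set η : ℝ → ℝ := fun x => I (s x) / s x ^ 2 with hη
  set r : ℝ → ℝ := fun x => s x / x with hr
  set a := 1 + 6 * (c + c ^ 2) with ha
  have a0 : 0 ≤ a := by positivity
  -- The coefficients are those of `abs_slope_sub_le` after splitting `κ = γ - η`, so that `C`, the
  -- dominator for `γ`, also receives the share `a * c ^ 2`.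
  set T : ℝ → ℝ := fun x => α x * r x + (1 + c) * A x + (1 + a * (c ^ 2 + c)) * C (s x) +
    (a + 4 * c) * A' x + a * c ^ 2 * C' (s x) with hT
  have r0 : ∀ x, 0 < x → 0 ≤ r x := fun x hx => div_nonneg (hs x hx).1 hx.le
  have rc : ∀ x, 0 < x → r x ≤ c := fun x hx => (div_le_iff₀ hx).2 (hs x hx).2.1
  have α0 : ∀ x, 0 < x → 0 ≤ α x := fun x hx => div_nonneg (P0 x hx.le) hx.le
  have γs : ∀ x, 0 < x → γ x * s x = Q (s x) := fun x hx => by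
    rcases eq_or_ne (s x) 0 with h0 | h0
    · simp [hγ, h0, h.zeroQ]
    · exact div_mul_cancel₀ _ h0
  have ηs : ∀ x, 0 < x → η x * s x ^ 2 = I (s x) := fun x hx => by
    rcases eq_or_ne (s x) 0 with h0 | h0
    · simp [hη, h0, I]
    · exact div_mul_cancel₀ _ (pow_ne_zero 2 h0)
  have ηγ : ∀ x, 0 < x → η x ≤ γ x := fun x hx => by
    rcases eq_or_lt_of_le (hs x hx).1 with h0 | h0
    · simp [hγ, hη, ← h0]
    · simp only [hγ, hη]
      rw [div_le_div_iff₀ (by positivity) h0]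
      nlinarith [I1 (s x) h0.le]
  have η0 : ∀ x, 0 < x → 0 ≤ η x := fun x hx => div_nonneg (I0 _ (hs x hx).1) (sq_nonneg _)
  -- Insert `M x = Q (s x) = γ x * s x` into the identity for the optimal average and divide by `x ^
  -- 2`.
  have quad : ∀ x, 0 < x → γ x * r x + (γ x - η x) * r x ^ 2 = β x := fun x hx => by
    have e4 := (hs x hx).2.2.2
    rw [← (hs x hx).2.2.1] at e4
    have h1 : γ x * r x + (γ x - η x) * r x ^ 2 =
        ((γ x * s x) * x + (γ x * s x) * s x - η x * s x ^ 2) / x ^ 2 := by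
      simp only [hr]; field_simp; ring
    rw [h1, γs x hx, ηs x hx]
    simp only [hβ]
    congr 1
    linarith
  have hm' : ∀ x, 0 < x → (P x - M x) / (x + s x) = (α x - r x * γ x) / (1 + r x) :=
    fun x hx => by
    have h1 : r x * γ x = Q (s x) / x := by
      rw [← γs x hx]; simp only [hr]; field_simp
    have h2 : x + s x ≠ 0 := by linarith [(hs x hx).1]
    have h3 : 1 + r x = (x + s x) / x := by simp only [hr]; field_simp
    rw [h1, h3, (hs x hx).2.2.1]
    simp only [hα]; field_simp
  refine ⟨T, fun x hx => ?_, DominatedOn.of_le_two_mul fun x y hx hxy hy2 => ?_⟩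
  · have t1 : |α x * r x| ≤ c * V := by
      rw [abs_of_nonneg (mul_nonneg (α0 x hx) (r0 x hx)), mul_comm]
      exact mul_le_mul (rc x hx) (hPV x hx) (α0 x hx) hc.le
    have t2 : |(1 + c) * A x| ≤ (1 + c) * V := by
      rw [abs_mul, abs_of_nonneg (by positivity : 0 ≤ 1 + c), abs_of_nonneg (A0 x)]
      gcongr; exact A1 x
    have t3 : |(1 + a * (c ^ 2 + c)) * C (s x)| ≤ (1 + a * (c ^ 2 + c)) * V := by
      rw [abs_mul, abs_of_nonneg (by positivity : 0 ≤ 1 + a * (c ^ 2 + c))]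
      gcongr; exact abs_le.2 ⟨C0 _, C1 _⟩
    have t4 : |(a + 4 * c) * A' x| ≤ (a + 4 * c) * V := by
      rw [abs_mul, abs_of_nonneg (by positivity : 0 ≤ a + 4 * c), abs_of_nonneg (A'0 x)]
      gcongr; exact A'1 x
    have t5 : |a * c ^ 2 * C' (s x)| ≤ a * c ^ 2 * V := by
      rw [abs_mul, abs_of_nonneg (by positivity : 0 ≤ a * c ^ 2)]
      gcongr; exact abs_le.2 ⟨C'0 _, C'1 _⟩
    have tot : c + (1 + c) + (1 + a * (c ^ 2 + c)) + (a + 4 * c) + a * c ^ 2 ≤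
        30 * (1 + c) ^ 4 := by
      have : 0 ≤ 30 * (1 + c) ^ 4 -
        (c + (1 + c) + (1 + a * (c ^ 2 + c)) + (a + 4 * c) + a * c ^ 2) := by
        have : 30 * (1 + c) ^ 4 -
          (c + (1 + c) + (1 + a * (c ^ 2 + c)) + (a + 4 * c) + a * c ^ 2) =
          27 + 107 * c + 166 * c ^ 2 + 102 * c ^ 3 + 18 * c ^ 4 := by
          simp only [ha]; ring
        rw [this]; positivity
      linarith
    calc |T x| ≤ |α x * r x| + |(1 + c) * A x| + |(1 + a * (c ^ 2 + c)) * C (s x)| +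
          |(a + 4 * c) * A' x| + |a * c ^ 2 * C' (s x)| := by
          simp only [hT]
          refine (abs_add_le _ _).trans (add_le_add_left ?_ _)
          refine (abs_add_le _ _).trans (add_le_add_left ?_ _)
          refine (abs_add_le _ _).trans (add_le_add_left ?_ _)
          exact abs_add_le _ _
      _ ≤ (c + (1 + c) + (1 + a * (c ^ 2 + c)) + (a + 4 * c) + a * c ^ 2) * V := by linarith
      _ ≤ _ := mul_le_mul_of_nonneg_right tot hV
  · have hy : 0 < y := hx.trans_le hxy
    rcases eq_or_lt_of_le hxy with rfl | hlt
    · simp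
    have hss : s x ≤ s y := hm hx hy hxy
    have main := abs_slope_sub_le (α' := α y) hx hlt hy2 (α0 x hx)
      (div_nonneg (J0 x hx.le) (sq_nonneg x)) ((η0 x hx).trans (ηγ x hx))
      (sub_nonneg.2 (ηγ x hx)) (r0 x hx) (r0 y hy) (rc x hx) (rc y hy)
      (by linarith [η0 x hx]) (quad x hx) (quad y hy)
      (by simp only [hr]; field_simp; exact hss) (by
        have d3 := le_integral h.contP h.monoP hx.le hxy
        rw [← integral_sub_integral h.contP] at d3
        have u1 : α x * x = P x := div_mul_cancel₀ _ hx.ne'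
        have u2 : J y / y ^ 2 * y ^ 2 = J y := div_mul_cancel₀ _ (pow_ne_zero 2 hy.ne')
        have u3 : J x / x ^ 2 * x ^ 2 = J x := div_mul_cancel₀ _ (pow_ne_zero 2 hx.ne')
        rw [u1, u2, u3]; exact d3)
    rw [hm' x hx, hm' y hy]
    refine main.trans ?_
    have v1 : |α y - α x| ≤ A y - A x := hA x hx y hy hxy
    have v2 : |β y - β x| ≤ A' y - A' x := hA' x hx y hy hxy
    have v3 : |γ y - γ x| ≤ C (s y) - C (s x) := hC _ (hs x hx).1 _ (hs y hy).1 hss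
    have v4 : |η y - η x| ≤ C' (s y) - C' (s x) := hC' _ (hs x hx).1 _ (hs y hy).1 hss
    have v5 : |(γ y - η y) - (γ x - η x)| ≤ |γ y - γ x| + |η y - η x| := by
      rw [sub_sub_sub_comm]; exact abs_sub _ _
    have w : (1 + c) * |α y - α x| + |γ y - γ x| +
        a * (|β y - β x| + c ^ 2 * |(γ y - η y) - (γ x - η x)| + c * |γ y - γ x|) +
          4 * c * |β y - β x| ≤
        (1 + c) * (A y - A x) + (C (s y) - C (s x)) +
        a * ((A' y - A' x) + c ^ 2 * ((C (s y) - C (s x)) + (C' (s y) - C' (s x))) +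
          c * (C (s y) - C (s x))) + 4 * c * (A' y - A' x) := by
      have := v5.trans (add_le_add v3 v4)
      gcongr
    have id1 : T y - T x = (α y * r y - α x * r x) + ((1 + c) * (A y - A x) + (C (s y) - C (s x)) +
        a * ((A' y - A' x) + c ^ 2 * ((C (s y) - C (s x)) + (C' (s y) - C' (s x))) +
          c * (C (s y) - C (s x))) + 4 * c * (A' y - A' x)) := by
      simp only [hT]; ring
    rw [id1]
    linarith

end Selection

theorem exists_deriv (h : IsHalfLineInf c P Q M) (hc : 0 < c)
    (hPV : ∀ x, 0 < x → P x / x ≤ V) (hQV : ∀ x, 0 < x → Q x / x ≤ V)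
    {A B : ℝ → ℝ} (Am : Monotone A) (A0 : ∀ x, 0 ≤ A x) (A1 : ∀ x, A x ≤ V)
    (hA : DominatedOn (fun x => P x / x) A (Ioi 0))
    (Bm : Monotone B) (B0 : ∀ x, 0 ≤ B x) (B1 : ∀ x, B x ≤ V)
    (hB : DominatedOn (fun x => Q x / x) B (Ioi 0)) :
    ContinuousOn M (Ioi 0) ∧ ∃ (m T : ℝ → ℝ) (D : Set ℝ), D.Countable ∧
      (∀ x, 0 < x → x ∉ D → HasDerivAt M (m x) x) ∧ (∀ x, 0 < x → 0 ≤ m x ∧ m x ≤ V) ∧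
      (∀ x, 0 < x → |T x| ≤ (30 * (1 + c) ^ 4) * V) ∧ DominatedOn m T (Ioi 0) := by
  obtain ⟨s, hm, hs⟩ := h.exists_monotone_selection
  have hM := h.continuousOn hPV hm hs
  obtain ⟨T, hT, hd⟩ := h.exists_dominatedOn hc hPV hQV Am A0 A1 hA Bm B0 B1 hB hm hs
  refine ⟨hM, _, T, _, hm.countable_not_continuousWithinAt, fun x hx hxD => ?_, fun x hx => ?_,
    hT, hd⟩
  · refine h.hasDerivAt hM hs hx ?_
    by_contra hne
    exact hxD ⟨hx, fun hw => hne (hw.continuousAt (Ioi_mem_nhds hx))⟩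
  · have s0 := (hs x hx).1
    have M0 : 0 ≤ M x := by
      rw [← (hs x hx).2.2.1, ← h.zeroQ]; exact h.monoQ self_mem_Ici s0 s0
    have hV : 0 ≤ V := (A0 0).trans (A1 0)
    refine ⟨div_nonneg (sub_nonneg.2 (h.le_P x hx)) (by linarith), ?_⟩
    rw [div_le_iff₀ (by linarith)]
    have := (div_le_iff₀ hx).1 (hPV x hx)
    have := mul_nonneg hV s0
    linarith

end IsHalfLineInf

/-! ### Reflection and change of representative -/

theorem average_comm (f : ℝ → ℝ) (a b : ℝ) : average f a b = average f b a := by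
  rw [average, average, intervalIntegral.integral_symm, ← neg_sub b a, inv_neg]; ring

theorem average_comp_neg (f : ℝ → ℝ) (a b : ℝ) :
    average (fun t => f (-t)) a b = average f (-a) (-b) := by
  rw [average_comm f, average, average, intervalIntegral.integral_comp_neg]
  congr 2; ring

theorem average_congr_ae {f F : ℝ → ℝ} (h : f =ᵐ[volume] F) (a b : ℝ) :
    average f a b = average F a b := by
  rw [average, average, intervalIntegral.integral_congr_ae (h.mono fun x hx _ => hx)]

theorem maximal_congr_ae {f F : ℝ → ℝ} (h : f =ᵐ[volume] F) : maximal f = maximal F := by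
  funext x; simp only [maximal, average_congr_ae h]

theorem maximal_comp_neg (f : ℝ → ℝ) (x : ℝ) :
    maximal (fun t => f (-t)) x = maximal f (-x) := by
  unfold maximal
  congr 1
  ext m
  simp only [mem_ofPred_eq, average_comp_neg]
  constructor
  · rintro ⟨a, b, ha, hb, rfl⟩
    exact ⟨-b, -a, by linarith, by linarith, average_comm _ _ _⟩
  · rintro ⟨a, b, ha, hb, rfl⟩
    exact ⟨-b, -a, by linarith, by linarith, by rw [neg_neg, neg_neg, average_comm]⟩

/-- For a fixed shift `d`, the points where `f = F` holds at both `t` and `t + d` are dense, and the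
inequality `F t ≤ F (t + d)` is closed. -/
theorem monotoneOn_Iic_of_ae_eq {f F : ℝ → ℝ} (h : f =ᵐ[volume] F) (hF : Continuous F)
    (hf : MonotoneOn f (Iio 0)) : MonotoneOn F (Iic 0) := by
  intro x hx y hy hxy
  obtain ⟨d, rfl⟩ : ∃ d, y = x + d := ⟨y - x, by ring⟩
  have hd : 0 ≤ d := by linarith
  have hy' : x + d ≤ 0 := hy
  have h2 : ∀ᵐ t, f (t + d) = F (t + d) :=
    (measurePreserving_add_right volume d).quasiMeasurePreserving.ae h
  have hdense : Dense {t | f t = F t ∧ f (t + d) = F (t + d)} := Measure.dense_of_ae (h.and h2)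
  have hcl : IsClosed {t | F t ≤ F (t + d)} := isClosed_le hF (by fun_prop)
  have hsub : Iio (-d) ⊆ {t | F t ≤ F (t + d)} := by
    refine (hdense.open_subset_closure_inter isOpen_Iio).trans (closure_minimal ?_ hcl)
    rintro t ⟨ht, e1, e2⟩
    have ht' : t < -d := ht
    rw [mem_ofPred_eq, ← e1, ← e2]
    exact hf (mem_Iio.2 (by linarith)) (mem_Iio.2 (by linarith)) (by linarith)
  have := closure_minimal hsub hcl
  rw [closure_Iio] at this
  exact this (mem_Iic.2 (by linarith))

theorem antitoneOn_Ici_of_ae_eq {f F : ℝ → ℝ} (h : f =ᵐ[volume] F) (hF : Continuous F)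
    (hf : AntitoneOn f (Ioi 0)) : AntitoneOn F (Ici 0) := by
  have h2 : (fun t => f (-t)) =ᵐ[volume] fun t => F (-t) :=
    (Measure.measurePreserving_neg volume).quasiMeasurePreserving.ae h
  have := monotoneOn_Iic_of_ae_eq h2 (hF.comp continuous_neg) fun x hx y hy hxy =>
    hf (mem_Ioi.2 (neg_pos.2 hy)) (mem_Ioi.2 (neg_pos.2 hx)) (neg_le_neg hxy)
  intro x hx y hy hxy
  have := this (mem_Iic.2 (neg_nonpos.2 hy)) (mem_Iic.2 (neg_nonpos.2 hx)) (neg_le_neg hxy)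
  simpa using this

/-! ### The maximal function of a continuous unimodal function -/

section Unimodal

variable {F : ℝ → ℝ}

theorem le_average {a b y : ℝ} (hF : Continuous F) (hab : a < b)
    (h : ∀ t ∈ Icc a b, y ≤ F t) : y ≤ average F a b := by
  have := intervalIntegral.integral_mono_on hab.le
    (intervalIntegrable_const (μ := volume) (c := y)) (hF.intervalIntegrable a b) h
  rw [intervalIntegral.integral_const, smul_eq_mul] at this
  rwa [average, le_inv_mul_iff₀ (by linarith)]

theorem average_le {a b y : ℝ} (hF : Continuous F) (hab : a < b)
    (h : ∀ t ∈ Icc a b, F t ≤ y) : average F a b ≤ y := by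
  have := intervalIntegral.integral_mono_on hab.le (hF.intervalIntegrable a b)
    (intervalIntegrable_const (μ := volume) (c := y)) h
  rw [intervalIntegral.integral_const, smul_eq_mul] at this
  rwa [average, inv_mul_le_iff₀ (by linarith)]

theorem le_apply_zero (hl : MonotoneOn F (Iic 0)) (hr : AntitoneOn F (Ici 0)) (x : ℝ) :
    F x ≤ F 0 := by
  rcases le_total x 0 with h | h
  · exact hl h self_mem_Iic h
  · exact hr self_mem_Ici h h

theorem average_le_maximal (hF : Continuous F) (h0 : ∀ x, F x ≤ F 0) {a b x : ℝ} (ha : a < x)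
    (hb : x < b) : average F a b ≤ maximal F x := by
  refine le_csSup ⟨F 0, ?_⟩ ⟨a, b, ha, hb, rfl⟩
  rintro _ ⟨a, b, ha, hb, rfl⟩
  exact average_le hF (ha.trans hb) fun t _ => h0 t

theorem maximal_le_apply_zero (hF : Continuous F) (h0 : ∀ x, F x ≤ F 0) (x : ℝ) :
    maximal F x ≤ F 0 := by
  refine csSup_le ⟨_, x - 1, x + 1, by linarith, by linarith, rfl⟩ ?_
  rintro _ ⟨a, b, ha, hb, rfl⟩
  exact average_le hF (ha.trans hb) fun t _ => h0 t

theorem le_maximal (hF : Continuous F) (h0 : ∀ x, F x ≤ F 0) (x : ℝ) : F x ≤ maximal F x := by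
  refine le_of_forall_sub_le fun ε hε => ?_
  obtain ⟨δ, hδ, h⟩ := Metric.continuousAt_iff.1 (hF.continuousAt (x := x)) ε hε
  refine le_trans (le_average hF (by linarith : x - δ / 2 < x + δ / 2) fun t ht => ?_)
    (average_le_maximal hF h0 (by linarith) (by linarith))
  have := h (x := t) (by rw [Real.dist_eq, abs_lt]; constructor <;> linarith [ht.1, ht.2])
  rw [Real.dist_eq] at this
  linarith [(abs_lt.1 this).1]

/-- The interval ending at `x` is not admissible in `maximal`; it is reached by letting the right
endpoint decrease to `x`. -/
theorem average_left_le_maximal (hF : Continuous F) (h0 : ∀ x, F x ≤ F 0) {a x : ℝ}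
    (ha : a < x) : average F a x ≤ maximal F x := by
  have hc : ContinuousAt (fun b => average F a b) x := by
    have h1 : Continuous fun b => ∫ t in a..b, F t :=
      intervalIntegral.continuous_primitive (fun p q => hF.intervalIntegrable p q) a
    exact ((continuousAt_id.sub continuousAt_const).inv₀ (by simp; linarith)).mul h1.continuousAt
  refine le_of_tendsto (hc.tendsto.mono_left (nhdsWithin_le_nhds (s := Ioi x))) ?_
  filter_upwards [self_mem_nhdsWithin] with b hb using average_le_maximal hF h0 ha hb

/-- At the origin, `maximal F` is squeezed between `F` and `F 0`. -/
theorem continuous_maximal (hF : Continuous F) (h0 : ∀ x, F x ≤ F 0)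
    (hr : ContinuousOn (maximal F) (Ioi 0)) (hl : ContinuousOn (maximal F) (Iio 0)) :
    Continuous (maximal F) := by
  refine continuous_iff_continuousAt.2 fun x => ?_
  rcases lt_trichotomy x 0 with hx | rfl | hx
  · exact hl.continuousAt (Iio_mem_nhds hx)
  · have e : maximal F 0 = F 0 := le_antisymm (maximal_le_apply_zero hF h0 0) (le_maximal hF h0 0)
    rw [ContinuousAt, e]
    exact tendsto_of_tendsto_of_tendsto_of_le_of_le hF.continuousAt tendsto_const_nhds
      (fun y => le_maximal hF h0 y) (fun y => maximal_le_apply_zero hF h0 y)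
  · exact hr.continuousAt (Ioi_mem_nhds hx)

theorem integral_sub_add_integral_sub (hF : Continuous F) (s x : ℝ) :
    (∫ t in (0 : ℝ)..s, (F 0 - F (-t))) + ∫ t in (0 : ℝ)..x, (F 0 - F t) =
      F 0 * (s + x) - ∫ t in (-s)..x, F t := by
  have hi : ∀ a b, IntervalIntegrable F volume a b := fun a b => hF.intervalIntegrable a b
  have hF' : Continuous fun t => F (-t) := by fun_prop
  rw [intervalIntegral.integral_sub (by simp) (hF'.intervalIntegrable _ _),
    intervalIntegral.integral_sub (by simp) (hi _ _), intervalIntegral.integral_comp_neg,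
    ← intervalIntegral.integral_add_adjacent_intervals (hi (-s) 0) (hi 0 x)]
  simp only [intervalIntegral.integral_const, smul_eq_mul, neg_zero]
  ring

theorem average_le_average_zero (hF : Continuous F) (hr : AntitoneOn F (Ici 0)) {x y : ℝ}
    (hy : 0 < y) (hyx : y < x) : average F y x ≤ average F 0 x := by
  have hi : ∀ a b, IntervalIntegrable F volume a b := fun a b => hF.intervalIntegrable a b
  have h1 : F y ≤ average F 0 y :=
    le_average hF hy fun t ht => hr ht.1 hy.le ht.2
  have h2 : average F y x ≤ F y :=
    average_le hF hyx fun t ht => hr hy.le (hy.le.trans ht.1) ht.1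
  have hx := hy.trans hyx
  have e1 : ∫ t in (0 : ℝ)..y, F t = y * average F 0 y := by
    rw [average, sub_zero, mul_inv_cancel_left₀ hy.ne']
  have e2 : ∫ t in y..x, F t = (x - y) * average F y x := by
    rw [average, mul_inv_cancel_left₀ (by linarith)]
  have e3 : average F 0 x = x⁻¹ * (y * average F 0 y + (x - y) * average F y x) := by
    rw [← e1, ← e2, intervalIntegral.integral_add_adjacent_intervals (hi _ _) (hi _ _), average,
      sub_zero]
  rw [e3, le_inv_mul_iff₀ hx]
  nlinarith

/-- Existence of the minimizer is compactness of `[0, c * x]`: by hypothesis other left endpoints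
are irrelevant, and positive ones do no better than `0` because `F` is nonincreasing there. -/
theorem isHalfLineInf_maximal {c : ℝ} (hc : 0 < c) (hF : Continuous F)
    (hl : MonotoneOn F (Iic 0)) (hr : AntitoneOn F (Ici 0))
    (hmax : ∀ x : ℝ, 0 < x → maximal F x =
      sSup {m : ℝ | ∃ y : ℝ, y ≠ x ∧ -(c * x) ≤ y ∧ m = average F y x}) :
    IsHalfLineInf c (fun x => F 0 - F x) (fun x => F 0 - F (-x)) (fun x => F 0 - maximal F x) where
  contP := by fun_prop
  contQ := by fun_prop
  monoP := fun x hx y hy hxy => sub_le_sub_left (hr hx hy hxy) _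
  monoQ := fun x hx y hy hxy => sub_le_sub_left
    (hl (mem_Iic.2 (neg_nonpos.2 hy)) (mem_Iic.2 (neg_nonpos.2 hx)) (neg_le_neg hxy)) _
  zeroP := by simp
  zeroQ := by simp
  le_P := fun x _ => sub_le_sub_left (le_maximal hF (le_apply_zero hl hr) x) _
  le_average := fun x s hx hs => by
    have h := average_left_le_maximal hF (le_apply_zero hl hr) (by linarith : -s < x)
    rw [average, inv_mul_le_iff₀ (by linarith)] at h
    rw [integral_sub_add_integral_sub hF]
    linarith
  exists_eq := fun x hx => by
    have h0 := le_apply_zero hl hr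
    have hcx : 0 < c * x := mul_pos hc hx
    have hcont : ContinuousOn (fun s => average F (-s) x) (Icc 0 (c * x)) := by
      have h1 : Continuous fun s => ∫ t in (-s)..x, F t := by
        simp_rw [intervalIntegral.integral_symm x]
        exact ((intervalIntegral.continuous_primitive (fun p q => hF.intervalIntegrable p q) x).comp
          continuous_neg).neg
      refine ContinuousOn.mul (ContinuousOn.inv₀ (by fun_prop) fun s hs => ?_) h1.continuousOn
      linarith [hs.1]
    obtain ⟨s, hs, hsmax⟩ := isCompact_Icc.exists_isMaxOn
      (nonempty_Icc.2 hcx.le) hcont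
    have hsx : -s < x := by linarith [hs.1]
    have e : maximal F x = average F (-s) x := by
      refine le_antisymm ?_ (average_left_le_maximal hF h0 hsx)
      rw [hmax x hx]
      refine csSup_le ⟨_, 0, hx.ne, by linarith, rfl⟩ ?_
      rintro _ ⟨y, hyx, hcy, rfl⟩
      have z : average F 0 x ≤ average F (-s) x := by
        simpa using hsmax (show (0 : ℝ) ∈ Icc 0 (c * x) from ⟨le_rfl, hcx.le⟩)
      rcases le_or_gt y 0 with hy | hy
      · have := hsmax (show -y ∈ Icc 0 (c * x) from ⟨by linarith, by linarith⟩)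
        simpa using this
      · refine le_trans ?_ z
        rcases lt_or_gt_of_ne hyx with h | h
        · exact average_le_average_zero hF hr hy h
        · rw [average_comm]
          exact (average_le hF h fun t ht => hr hx.le (hx.le.trans ht.1) ht.1).trans
            (le_average hF hx fun t ht => hr ht.1 hx.le ht.2)
    have e2 : ∫ t in (-s)..x, F t = maximal F x * (s + x) := by
      rw [e, average, show s + x = x - -s by ring, mul_comm,
        mul_inv_cancel_left₀ (by linarith)]
    refine ⟨s, hs.1, hs.2, ?_, ?_⟩
    · have hloc : IsLocalMax (fun y => (∫ t in y..x, F t) - maximal F x * (x - y)) (-s) := by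
        filter_upwards [Iio_mem_nhds hsx] with y hy
        have h := average_left_le_maximal hF h0 hy
        rw [average, inv_mul_le_iff₀ (sub_pos.2 hy)] at h
        rw [e2]; linarith
      have hd : HasDerivAt (fun y => (∫ t in y..x, F t) - maximal F x * (x - y))
          (-F (-s) - maximal F x * (-1)) (-s) := by
        refine HasDerivAt.sub ?_ (((hasDerivAt_id _).const_sub x).const_mul _)
        exact intervalIntegral.integral_hasDerivAt_left (hF.intervalIntegrable _ _)
          (hF.stronglyMeasurableAtFilter _ _) hF.continuousAt
      have := hloc.hasDerivAt_eq_zero hd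
      linarith
    · rw [integral_sub_add_integral_sub hF, e2]; ring

end Unimodal

/-! ### Gluing the half-lines and conclusion -/

/-- Gluing two one-sided derivatives: the two half-lines are combined to a function on `ℝ`. -/
theorem exists_dominatedOn_glue {m₁ m₂ T₁ T₂ : ℝ → ℝ} {V W : ℝ}
    (hm₁ : ∀ x, 0 < x → 0 ≤ m₁ x ∧ m₁ x ≤ V) (hm₂ : ∀ x, 0 < x → 0 ≤ m₂ x ∧ m₂ x ≤ V)
    (hT₁ : ∀ x, 0 < x → |T₁ x| ≤ W) (hT₂ : ∀ x, 0 < x → |T₂ x| ≤ W)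
    (hd₁ : DominatedOn m₁ T₁ (Ioi 0)) (hd₂ : DominatedOn m₂ T₂ (Ioi 0)) :
    ∃ h T : ℝ → ℝ, (∀ x, 0 < x → h x = -m₁ x) ∧ (∀ x, x < 0 → h x = m₂ (-x)) ∧
      DominatedOn h T univ ∧ (∀ x, -W ≤ T x) ∧ ∀ x, T x ≤ -W + (4 * W + 2 * V) := by
  have hV : 0 ≤ V := (hm₁ 1 one_pos).1.trans (hm₁ 1 one_pos).2
  have hW : 0 ≤ W := (abs_nonneg _).trans (hT₁ 1 one_pos)
  set h : ℝ → ℝ := fun x => if 0 < x then -m₁ x else if x < 0 then m₂ (-x) else 0 with hh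
  -- The offsets leave a gap of at least `V` on either side of the origin, enough for the jumps of
  -- `h` there, and `T` ranges within `[-W, 3 * W + 2 * V]`.
  set T : ℝ → ℝ := fun x => if 0 < x then 2 * W + 2 * V + T₁ x else
    if x < 0 then -T₂ (-x) else W + V with hT
  have h1 : ∀ x, 0 < x → h x = -m₁ x := fun x hx => if_pos hx
  have h2 : ∀ x, x < 0 → h x = m₂ (-x) := fun x hx => by
    simp only [hh, if_neg hx.le.not_gt, if_pos hx]
  have h3 : h 0 = 0 := by simp [hh]
  have t1 : ∀ x, 0 < x → T x = 2 * W + 2 * V + T₁ x := fun x hx => if_pos hx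
  have t2 : ∀ x, x < 0 → T x = -T₂ (-x) := fun x hx => by
    simp only [hT, if_neg hx.le.not_gt, if_pos hx]
  have t3 : T 0 = W + V := by simp [hT]
  refine ⟨h, T, h1, h2, fun x _ y _ hxy => ?_, fun x => ?_, fun x => ?_⟩
  · rcases lt_trichotomy x 0 with hx | rfl | hx
    · have a := abs_le.1 (hT₂ (-x) (neg_pos.2 hx))
      have b := hm₂ (-x) (neg_pos.2 hx)
      rcases lt_trichotomy y 0 with hy | rfl | hy
      · rw [h2 x hx, h2 y hy, t2 x hx, t2 y hy, abs_sub_comm]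
        have := hd₂ (-y) (neg_pos.2 hy) (-x) (neg_pos.2 hx) (neg_le_neg hxy)
        linarith
      · rw [h2 x hx, h3, t2 x hx, t3, abs_le]
        constructor <;> linarith
      · have a' := abs_le.1 (hT₁ y hy)
        have b' := hm₁ y hy
        rw [h2 x hx, h1 y hy, t2 x hx, t1 y hy, abs_le]
        constructor <;> linarith
    · rcases eq_or_lt_of_le hxy with rfl | hy
      · simp
      · have a' := abs_le.1 (hT₁ y hy)
        have b' := hm₁ y hy
        rw [h3, h1 y hy, t3, t1 y hy, abs_le]
        constructor <;> linarith
    · have hy := hx.trans_le hxy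
      rw [h1 x hx, h1 y hy, t1 x hx, t1 y hy]
      have := hd₁ x hx y hy hxy
      rw [show -m₁ y - -m₁ x = -(m₁ y - m₁ x) by ring, abs_neg]
      linarith
  all_goals
    rcases lt_trichotomy x 0 with hx | rfl | hx
    · have a := abs_le.1 (hT₂ (-x) (neg_pos.2 hx))
      rw [t2 x hx]; linarith
    · rw [t3]; linarith
    · have a := abs_le.1 (hT₁ x hx)
      rw [t1 x hx]; linarith

theorem hasWeakDeriv_maximal_and_variation_le {c V : ℝ} (hc : 0 < c) {F k v : ℝ → ℝ}
    (hk : ∀ x y, F y - F x = ∫ t in x..y, k t) (hd : DominatedOn k v univ)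
    (v0 : ∀ x, 0 ≤ v x) (v1 : ∀ x, v x ≤ V) (hF : Continuous F)
    (hl : MonotoneOn F (Iic 0)) (hr : AntitoneOn F (Ici 0))
    (hmax : ∀ x : ℝ, 0 < x → maximal F x =
      sSup {m : ℝ | ∃ y : ℝ, y ≠ x ∧ -(c * x) ≤ y ∧ m = average F y x})
    (hmax' : ∀ x : ℝ, x < 0 → maximal F x =
      sSup {m : ℝ | ∃ y : ℝ, y ≠ x ∧ y ≤ -(c * x) ∧ m = average F y x}) :
    ∃ h : ℝ → ℝ, HasWeakDeriv (maximal F) h ∧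
      variation h ≤ ENNReal.ofReal ((4 * (30 * (1 + c) ^ 4) + 2) * V) := by
  have h0 := le_apply_zero hl hr
  have kI : ∀ a b, IntervalIntegrable k volume a b := fun a b =>
    (hd.locallyIntegrable.integrableOn_isCompact isCompact_uIcc).intervalIntegrable
  have kI' : ∀ a b, IntervalIntegrable (fun t => k (-t)) volume a b := fun a b => by
    simpa using (kI (-a) (-b)).comp_mul_left (c := -1)
  have hP : ∀ x, F 0 - F x = ∫ t in (0 : ℝ)..x, -k t := fun x => by
    rw [intervalIntegral.integral_neg, ← hk]; ring
  have hQ : ∀ x, F 0 - F (-x) = ∫ t in (0 : ℝ)..x, k (-t) := fun x => by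
    rw [intervalIntegral.integral_comp_neg, neg_zero, hk]
  -- The integrand `k (-t) - k t` is at most `v t - v (-t) ≤ V`. Both summands are nonnegative
  -- because `F` peaks at `0`, so each one alone is at most `V * x`.
  have hsum : ∀ x, 0 < x → (F 0 - F x) + (F 0 - F (-x)) ≤ V * x := fun x hx => by
    rw [hP, hQ, ← intervalIntegral.integral_add (by exact (kI _ _).neg) (kI' _ _)]
    have := intervalIntegral.integral_mono_on hx.le ((kI 0 x).neg.add (kI' 0 x))
      (intervalIntegrable_const (μ := volume) (c := V)) fun t ht => by
        have := (abs_le.1 (hd (-t) trivial t trivial (by linarith [ht.1]))).1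
        show -k t + k (-t) ≤ V
        linarith [v0 (-t), v1 t]
    simpa [mul_comm] using this
  have hPV : ∀ x, 0 < x → (F 0 - F x) / x ≤ V := fun x hx => by
    rw [div_le_iff₀ hx]; linarith [hsum x hx, h0 (-x)]
  have hQV : ∀ x, 0 < x → (F 0 - F (-x)) / x ≤ V := fun x hx => by
    rw [div_le_iff₀ hx]; linarith [hsum x hx, h0 x]
  have hd₁ : DominatedOn (fun t => -k t) v univ := fun x hx y hy hxy => by
    have := hd x hx y hy hxy
    rwa [← neg_sub', abs_neg]
  -- Reflection reverses monotonicity, so the dominator is reflected and subtracted from `V` to stay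
  -- in `[0, V]`.
  have hd₂ : DominatedOn (fun t => k (-t)) (fun t => V - v (-t)) univ := fun x _ y _ hxy => by
    have := hd (-y) trivial (-x) trivial (neg_le_neg hxy)
    rw [abs_sub_comm]; linarith
  obtain ⟨A, Am, A0, A1, hA⟩ := hd₁.exists_average v0 v1 hP
  obtain ⟨B, Bm, B0, B1, hB⟩ := hd₂.exists_average (V := V) (fun x => by linarith [v1 (-x)])
    (fun x => by linarith [v0 (-x)]) hQ
  obtain ⟨c₁, m₁, T₁, D₁, hD₁, hm₁, b₁, hT₁, hdd₁⟩ :=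
    (isHalfLineInf_maximal hc hF hl hr hmax).exists_deriv hc hPV hQV Am A0 A1 hA Bm B0 B1 hB
  have hrefl := isHalfLineInf_maximal (F := fun t => F (-t)) hc (by fun_prop)
    (fun x hx y hy hxy => hr (mem_Ici.2 (neg_nonneg.2 hy)) (mem_Ici.2 (neg_nonneg.2 hx))
      (neg_le_neg hxy))
    (fun x hx y hy hxy => hl (mem_Iic.2 (neg_nonpos.2 hy)) (mem_Iic.2 (neg_nonpos.2 hx))
      (neg_le_neg hxy)) (fun x hx => by
      rw [maximal_comp_neg, hmax' (-x) (neg_neg_of_pos hx)]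
      congr 1
      ext m
      simp only [mem_ofPred_eq, average_comp_neg]
      constructor
      · rintro ⟨y, h1, h2, rfl⟩
        exact ⟨-y, fun e => h1 (by linarith), by linarith, by rw [neg_neg]⟩
      · rintro ⟨y, h1, h2, rfl⟩
        exact ⟨-y, fun e => h1 (by linarith), by linarith, rfl⟩)
  simp only [neg_neg, neg_zero, maximal_comp_neg] at hrefl
  obtain ⟨c₂, m₂, T₂, D₂, hD₂, hm₂, b₂, hT₂, hdd₂⟩ :=
    hrefl.exists_deriv hc hQV hPV Bm B0 B1 hB Am A0 A1 hA
  obtain ⟨h, T, e1, e2, hdT, l, u⟩ := exists_dominatedOn_glue b₁ b₂ hT₁ hT₂ hdd₁ hdd₂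
  have cont : Continuous (maximal F) := by
    refine continuous_maximal hF h0 ?_ ?_
    · refine (continuousOn_const (c := F 0)|>.sub c₁).congr fun x _ => by simp
    · have := (continuousOn_const (c := F 0)|>.sub c₂).comp (f := fun x : ℝ => -x) (s := Iio 0)
        continuous_neg.continuousOn fun x hx => mem_Ioi.2 (neg_pos.2 hx)
      exact this.congr fun x _ => by simp
  have deriv : ∀ x ∉ D₁ ∪ (fun x => -x) '' D₂ ∪ {0}, HasDerivAt (maximal F) (h x) x := by
    intro x hx
    simp only [mem_union, mem_singleton_iff, not_or] at hx
    obtain ⟨⟨hx1, hx2⟩, hx3⟩ := hx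
    rcases lt_or_gt_of_ne hx3 with hx | hx
    · rw [e2 x hx]
      have hn : -x ∉ D₂ := fun hh => hx2 ⟨-x, hh, neg_neg x⟩
      have := ((hm₂ (-x) (neg_pos.2 hx) hn).scomp x (hasDerivAt_neg x)).const_sub (F 0)
      simpa [Function.comp_def] using this
    · rw [e1 x hx]
      simpa using (hm₁ x hx hx1).const_sub (F 0)
  refine ⟨h, ⟨cont.locallyIntegrable, hdT.locallyIntegrable, fun φ p1 p2 => ?_⟩, ?_⟩
  · exact integral_mul_eq_neg_integral_mul_deriv
      ((hD₁.union (hD₂.image _)).union (countable_singleton 0)) cont deriv hdT.locallyIntegrable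
      p1 p2
  · refine (variation_le_of_dominatedOn hdT l u).trans (le_of_eq ?_)
    congr 1; ring

end SecondDerivMaximal

theorem mainTheorem1 :
    ∀ c : ℝ, 0 < c → ∃ C : ℝ, 0 < C ∧ ∀ f : ℝ → ℝ,
      MonotoneOn f (Set.Iio 0) → AntitoneOn f (Set.Ioi 0) →
      (∀ x : ℝ, 0 < x → SecondDerivMaximal.maximal f x =
        sSup {m : ℝ | ∃ y : ℝ, y ≠ x ∧ -(c * x) ≤ y ∧ m = SecondDerivMaximal.average f y x}) →
      (∀ x : ℝ, x < 0 → SecondDerivMaximal.maximal f x =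
        sSup {m : ℝ | ∃ y : ℝ, y ≠ x ∧ y ≤ -(c * x) ∧ m = SecondDerivMaximal.average f y x}) →
      SecondDerivMaximal.variationDeriv (SecondDerivMaximal.maximal f) ≤
        ENNReal.ofReal C * SecondDerivMaximal.variationDeriv f := by
  intro c hc
  have hC : 0 < 4 * (30 * (1 + c) ^ 4) + 2 := by positivity
  refine ⟨4 * (30 * (1 + c) ^ 4) + 2, hC, fun f hl hr hmax hmax' => ?_⟩
  have hC0 : ENNReal.ofReal (4 * (30 * (1 + c) ^ 4) + 2) ≠ 0 := (ENNReal.ofReal_pos.2 hC).ne'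
  unfold SecondDerivMaximal.variationDeriv
  -- With the constant inside the infimum, it suffices to treat one weak derivative `g` at a time;
  -- if there is none, the right-hand side is `⊤`.
  rw [ENNReal.mul_iInf_of_ne hC0 ENNReal.ofReal_ne_top]
  refine le_iInf fun g => ?_
  rw [ENNReal.mul_iInf_of_ne hC0 ENNReal.ofReal_ne_top]
  refine le_iInf fun hg => ?_
  rcases eq_or_ne (SecondDerivMaximal.variation g) ⊤ with htop | htop
  · rw [htop, ENNReal.mul_top hC0]; exact le_top
  obtain ⟨k, v, hk, hd, v0, v1⟩ := SecondDerivMaximal.exists_dominatedOn_representative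
    hg.locallyIntegrable_deriv (ENNReal.ofReal_toReal htop).ge ENNReal.toReal_nonneg
  obtain ⟨F, hfF, hF⟩ := hg.exists_primitive hk hd
  have Fc : Continuous F := by
    have : F = fun x => F 0 + ∫ t in (0 : ℝ)..x, k t := funext fun x => by rw [← hF]; ring
    rw [this]
    exact continuous_const.add (intervalIntegral.continuous_primitive (fun a b =>
      (hd.locallyIntegrable.integrableOn_isCompact isCompact_uIcc).intervalIntegrable) 0)
  simp only [SecondDerivMaximal.maximal_congr_ae hfF,
    SecondDerivMaximal.average_congr_ae hfF] at hmax hmax' ⊢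
  obtain ⟨h, hw, hv⟩ := SecondDerivMaximal.hasWeakDeriv_maximal_and_variation_le hc hF hd v0 v1 Fc
    (SecondDerivMaximal.monotoneOn_Iic_of_ae_eq hfF Fc hl)
    (SecondDerivMaximal.antitoneOn_Ici_of_ae_eq hfF Fc hr) hmax hmax'
  refine (iInf₂_le h hw).trans (hv.trans (le_of_eq ?_))
  rw [ENNReal.ofReal_mul hC.le, ENNReal.ofReal_toReal htop]
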